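/- Let $V\ge 1$, let $\Delta^{V-1}$ be the probability simplex in $\mathbb R^V$, and fix a known concentration parameter $\bar\alpha>0$. Let $\mathcal E_k$ be the set of discrete probability measures on $\Delta^{V-1}$ with exactly $k$ atoms and $\mathcal O_K=\bigcup_{k=1}^K\mathcal E_k$. For $G=\sum_{k=1}^{K}w_k\delta_{\theta_k}\in\mathcal E_K$ and $N\ge 1$, the LDA (Latent Dirichlet Allocation) and mixture-of-products models for a document $x\in\{1,\dots,V\}^N$ have the probability functions $$p^{\mathscr L}_{G,N}(x)=\mathbb E_{q\sim\mathrm{Dir}(\bar\alpha w_1,\dots,\bar\alpha w_K)}\prod_{n=1}^N\sum_{k=1}^K q_k\theta_{k x_n},\qquad p^{\mathscr M}_{G,N}(x)=\sum_{k=1}^K w_k\prod_{n=1}^N\theta_{k x_n}.$$ For either model $p$ and $G_0\in\mathcal E_{K_0}$, let $\mathfrak N_e(G_0)$ be the smallest $N\ge 1$ such that, for all $G\in\mathcal O_{K_0}$, $p_{G_0,N}=p_{G,N}$ implies $G=G_0$; for $K>K_0$ let $\mathfrak N_o(G_0,K)$ be the smallest $N\ge1$ such that the same implication holds for all $G\in\mathcal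 O_K$. Let $G_0=\sum_{j=1}^{K_0}w_j^0\delta_{\theta_j^0}\in\mathcal E_{K_0}$, let $R=\dim\operatorname{span}\{\theta^0_1,\dots,\theta^0_{K_0}\}$, and let $R_K$ be the Kruskal rank of the topics, i.e. the largest $r\le K_0$ such that any $r$ of the vectors $\theta^0_1,\dots,\theta^0_{K_0}$ are linearly independent. Then, for the LDA model as well as for the mixture-of-products model, the minimal lengths exist and, for every $K>K_0$: 1. (distinct topics, i.e. no further assumption) $\mathfrak N_e(G_0)\le 2K_0-1$ and $\mathfrak N_o(G_0,K)\le 2K_0$; 2. (rank $R$, Kruskal rank $R_K$) $\mathfrak N_e(G_0)\le\lceil(2K_0-1)/(R_K-1)\rceil$ if $K_0\ge 2$, and $\mathfrak N_o(G_0,K)\le K+K_0+3-2R$; 3. if $\theta^0_1,\dots,\theta^0_{K_0}$ are linearly independent, then $\mathfrak N_e(G_0)\le 3$ and $\mathfrak N_o(G_0,K)\le 4$; 4. if the anchor-word condition holds, i.e. for every $k$ there is a word $v$ with $\theta^0_{kv}>0$ and $\theta^0_{k'v}=0$ for all $k'\ne k$, then $\mathfrak N_e(G_0)\le 2$ and $\mathfrak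 N_o(G_0,K)\le 2$. -/

import Mathlib

open MeasureTheory

noncomputable section

/-- The probability simplex on a vocabulary of `V` words; its points are the topics. -/
abbrev Topic (V : ℕ) : Type := stdSimplex ℝ (Fin V)

/-- A finitely supported discrete probability measure `G = ∑ θ, w θ • δ_θ` on the simplex of
topics, recorded by its masses. The atoms of `G` are the points of `weight.support`. -/
@[ext]
structure MixingMeasure (V : ℕ) where
  /-- the mass that the measure gives to each topic -/
  weight : Topic V →₀ ℝ
  nonneg : ∀ θ, 0 ≤ weight θ
  sum_eq_one : ∑ θ ∈ weight.support, weight θ = 1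

/-- The finite set of atoms (topics of positive mass). -/
def MixingMeasure.atoms {V : ℕ} (G : MixingMeasure V) : Finset (Topic V) := G.weight.support

/-- `𝓔_K`: the discrete probability measures on the simplex with exactly `K` atoms. -/
def exactAtoms (V K : ℕ) : Set (MixingMeasure V) := {G | G.atoms.card = K}

/-- `𝓞_K = ⋃_{k = 1}^K 𝓔_k`: the discrete probability measures with at most `K` atoms. -/
def atMostAtoms (V K : ℕ) : Set (MixingMeasure V) := ⋃ k ∈ Finset.Icc 1 K, exactAtoms V k

/-- The Dirichlet distribution with parameter `α` (all `α i > 0`): the law of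
`(g_i / ∑ j, g_j)_i`, where the `g_i` are independent Gamma variables of shape `α i` and rate `1`. -/
def dirichletMeasure {ι : Type*} [Fintype ι] (α : ι → ℝ) : Measure (ι → ℝ) :=
  (Measure.pi fun i => ProbabilityTheory.gammaMeasure (α i) 1).map
    fun g i => g i / ∑ j, g j

/-- The LDA probability function of a document `x` of length `N`, with Dirichlet parameter `α` and
topics `Θ`: `𝔼_{q ∼ Dir(α)} ∏_n ∑_k q_k Θ_{k, x_n}`. -/
def ldaProb {V : ℕ} {ι : Type*} [Fintype ι] (α : ι → ℝ) (Θ : ι → Topic V)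
    (N : ℕ) (x : Fin N → Fin V) : ℝ :=
  ∫ q, ∏ n, ∑ k, q k * (Θ k).1 (x n) ∂(dirichletMeasure α)

/-- The mixture-of-products probability function of a document `x` of length `N`, with mixing
probabilities `w` and topics `Θ`: `∑_k w_k ∏_n Θ_{k, x_n}`. -/
def mixtureProb {V : ℕ} {ι : Type*} [Fintype ι] (w : ι → ℝ) (Θ : ι → Topic V)
    (N : ℕ) (x : Fin N → Fin V) : ℝ :=
  ∑ k, w k * ∏ n, (Θ k).1 (x n)

/-- A model assigns to a mixing measure and a document length `N` a function on documents. -/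
abbrev DocumentModel (V : ℕ) : Type :=
  MixingMeasure V → (N : ℕ) → (Fin N → Fin V) → ℝ

/-- The LDA model with known concentration parameter `abar`, parametrized by the mixing measure
`G`: the topics are the atoms of `G`, and the Dirichlet parameter of an atom is `abar` times its
mass. -/
def ldaModel (V : ℕ) (abar : ℝ) : DocumentModel V := fun G N x =>
  ldaProb (fun θ : G.atoms => abar * G.weight θ) (fun θ : G.atoms => (θ : Topic V)) N x

/-- The mixture-of-products model, parametrized by the mixing measure. -/
def mixtureModel (V : ℕ) : DocumentModel V := fun G N x =>
  mixtureProb (fun θ : G.atoms => G.weight θ) (fun θ : G.atoms => (θ : Topic V)) N x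

/-- At document length `N`, the measure `G₀` is determined by its document distribution among all
mixing measures with at most `K` atoms. -/
def IdentifiableUpTo {V : ℕ} (p : DocumentModel V) (G₀ : MixingMeasure V) (K N : ℕ) : Prop :=
  ∀ G ∈ atMostAtoms V K, p G₀ N = p G N → G = G₀

/-- The least document length `N ≥ 1` at which `G₀` is over-fitted identifiable up to order `K`,
as an extended natural number (`⊤` if there is none). -/
def minOverfittedLength {V : ℕ} (p : DocumentModel V) (G₀ : MixingMeasure V) (K : ℕ) : ℕ∞ :=
  sInf {L : ℕ∞ | ∃ N : ℕ, 1 ≤ N ∧ IdentifiableUpTo p G₀ K N ∧ L = N}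

/-- The least document length `N ≥ 1` at which `G₀` is exact-fitted identifiable, that is,
identifiable among the measures with no more atoms than `G₀` itself (`⊤` if there is none). -/
def minExactLength {V : ℕ} (p : DocumentModel V) (G₀ : MixingMeasure V) : ℕ∞ :=
  sInf {L : ℕ∞ | ∃ N : ℕ, 1 ≤ N ∧ IdentifiableUpTo p G₀ G₀.atoms.card N ∧ L = N}

/-- The topics of `G` as a family of vectors of `ℝ^V`, indexed by the atoms. -/
def topicVec {V : ℕ} (G : MixingMeasure V) : G.atoms → Fin V → ℝ := fun θ => θ.1.1

/-- The rank of a family of vectors: the dimension of its span. -/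
def familyRank {ι E : Type*} [AddCommGroup E] [Module ℝ E] (v : ι → E) : ℕ :=
  Module.finrank ℝ (Submodule.span ℝ (Set.range v))

/-- The Kruskal rank of a finite family of vectors: the largest `r` (at most the number of vectors)
such that any `r` of them are linearly independent. -/
def kruskalRank {ι E : Type*} [Fintype ι] [AddCommGroup E] [Module ℝ E] (v : ι → E) : ℕ :=
  sSup {r : ℕ | r ≤ Fintype.card ι ∧
    ∀ S : Finset ι, S.card = r → LinearIndependent ℝ fun i : S => v i}

/-- The anchor-word condition: each topic has a word of positive probability under it and of
probability zero under every other topic. -/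
def AnchorWord {V : ℕ} (G : MixingMeasure V) : Prop :=
  ∀ θ ∈ G.atoms, ∃ v : Fin V, 0 < θ.1 v ∧ ∀ θ' ∈ G.atoms, θ' ≠ θ → θ'.1 v = 0

end

/-!
Both models are reduced to one statement about moments: if two mixing measures give the same
distribution to documents of length `N`, they give the same integral to every polynomial function
of degree at most `N` on the simplex (`MomentsAgree`). For the mixture model this is immediate, as
the document probabilities are the integrals of the monomials. For the LDA model, the Dirichlet
vector is a normalized vector of independent Gamma variables, and its moments of order `N` are the
weights of Pólya's urn up to a factor depending only on `N` and the total mass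
(`integral_prod_dirichletMeasure`). The urn recursion (`urnSum_cons_const`) peels off one draw at
a time and so recovers, by induction, the integrals of the powers `f ^ j`, `j ≤ N`, of linear
forms `f` (`momentsAgree_of_ldaModel`); polarization gives all polynomials of degree `N`.

It remains to find `G₀` from its moments, and this is a matter of test polynomials. One that
vanishes at all atoms of both measures but one shows that the two masses of that atom agree
(`MomentsAgree.eq_of_separated`). The square of one that vanishes at the atoms of `G₀` has
integral zero, so that the polynomial vanishes at the atoms of `G` as well
(`MomentsAgree.eq_zero_of_eq_zero`); hence the atoms of both measures have the same linear span,
and in most over-fitted cases the atoms of `G` are found among those of `G₀`. The test polynomials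
are products of linear forms: one form for each atom to be killed in general; forms that kill
`R - 1` atoms at once if the rank is `R` (`MomentsAgree.eq_of_rank`); products of two coordinate forms
for linearly independent topics and for anchor words.

The bound by the Kruskal rank `k` is Kruskal's theorem on the uniqueness of tensor decompositions.
Here a form can be made to kill any `k - 1` atoms of `G₀`, but nothing similar is known of the
atoms of `G`. The main step, `MomentsAgree.card_filter_le`, is that a hyperplane containing enough
atoms of `G` misses at most as many atoms of `G₀` as of `G`. Kruskal's permutation lemma
(`card_filter_notMem_le_of_hyperplanes`) carries this over from hyperplanes to lines, where it
says that every atom of `G` is one of `G₀`.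
-/

/-! ### Forms on the simplex and moments -/

/-- The space of linear forms of `ℝ^V`, restricted to the simplex. Since the coordinates of a topic
sum to one, it contains the constants; its power `coordSpan V ^ N` is the space of
polynomial functions of degree at most `N` on the simplex. -/
noncomputable def coordSpan (V : ℕ) : Submodule ℝ (Topic V → ℝ) :=
  Submodule.span ℝ (Set.range fun (v : Fin V) (θ : Topic V) => θ.1 v)

lemma coord_mem_coordSpan {V : ℕ} (v : Fin V) : (fun θ : Topic V => θ.1 v) ∈ coordSpan V :=
  Submodule.subset_span ⟨v, rfl⟩

lemma dual_mem_coordSpan {V : ℕ} (l : (Fin V → ℝ) →ₗ[ℝ] ℝ) :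
    (fun θ : Topic V => l θ.1) ∈ coordSpan V := by
  have h : (fun θ : Topic V => l θ.1)
      = ∑ v, l (Pi.single v 1) • (fun θ : Topic V => θ.1 v) := by
    funext θ
    simp only [Finset.sum_apply, Pi.smul_apply, smul_eq_mul]
    rw [LinearMap.pi_apply_eq_sum_univ l θ.1]
    refine Finset.sum_congr rfl fun v _ => ?_
    rw [smul_eq_mul, mul_comm]
    congr 2
    funext j
    simp [Pi.single_apply, eq_comm]
  rw [h]
  exact Submodule.sum_mem _ fun v _ => Submodule.smul_mem _ _ (coord_mem_coordSpan v)

lemma one_mem_coordSpan (V : ℕ) : (1 : Topic V → ℝ) ∈ coordSpan V := by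
  have h : (1 : Topic V → ℝ) = ∑ v, (fun θ : Topic V => θ.1 v) := by
    funext θ
    simpa using θ.2.2.symm
  rw [h]
  exact Submodule.sum_mem _ fun v _ => coord_mem_coordSpan v

lemma coordSpan_pow_mono {V : ℕ} {m n : ℕ} (h : m ≤ n) : coordSpan V ^ m ≤ coordSpan V ^ n := by
  intro f hf
  obtain ⟨d, rfl⟩ := Nat.exists_eq_add_of_le h
  rw [pow_add, ← mul_one f]
  refine Submodule.mul_mem_mul hf ?_
  simpa using Submodule.pow_mem_pow (coordSpan V) (one_mem_coordSpan V) d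

lemma mul_mem_coordSpan_pow {V : ℕ} {m n N : ℕ} {f g : Topic V → ℝ}
    (hf : f ∈ coordSpan V ^ m) (hg : g ∈ coordSpan V ^ n) (h : m + n ≤ N) :
    f * g ∈ coordSpan V ^ N :=
  coordSpan_pow_mono h (by rw [pow_add]; exact Submodule.mul_mem_mul hf hg)

lemma mem_coordSpan_pow_one {V : ℕ} {f : Topic V → ℝ} (hf : f ∈ coordSpan V) :
    f ∈ coordSpan V ^ 1 := by simpa using hf

/-- The integral of a function on the simplex with respect to a mixing measure. -/
noncomputable def MixingMeasure.integral {V : ℕ} (G : MixingMeasure V) :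
    (Topic V → ℝ) →ₗ[ℝ] ℝ where
  toFun f := ∑ θ ∈ G.atoms, G.weight θ * f θ
  map_add' f g := by simp [mul_add, Finset.sum_add_distrib]
  map_smul' c f := by
    simp only [Pi.smul_apply, smul_eq_mul, RingHom.id_apply, Finset.mul_sum]
    exact Finset.sum_congr rfl fun _ _ => by ring

lemma MixingMeasure.integral_apply {V : ℕ} (G : MixingMeasure V) (f : Topic V → ℝ) :
    G.integral f = ∑ θ ∈ G.atoms, G.weight θ * f θ := rfl

lemma MixingMeasure.mem_atoms {V : ℕ} {G : MixingMeasure V} {θ : Topic V} :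
    θ ∈ G.atoms ↔ G.weight θ ≠ 0 := Finsupp.mem_support_iff

lemma MixingMeasure.weight_pos {V : ℕ} {G : MixingMeasure V} {θ : Topic V} (h : θ ∈ G.atoms) :
    0 < G.weight θ := lt_of_le_of_ne (G.nonneg θ) (Ne.symm (MixingMeasure.mem_atoms.1 h))

/-- If `f` vanishes at all atoms but possibly `θ`, then only `θ` contributes to its integral;
`θ` need not be an atom. -/
lemma MixingMeasure.integral_eq_single {V : ℕ} (G : MixingMeasure V) {f : Topic V → ℝ}
    (θ : Topic V) (h : ∀ η ∈ G.atoms, η ≠ θ → f η = 0) : G.integral f = G.weight θ * f θ := by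
  rw [G.integral_apply]
  refine Finset.sum_eq_single θ (fun η hη hne => by rw [h η hη hne, mul_zero]) fun hθ => ?_
  rw [MixingMeasure.mem_atoms, not_not] at hθ
  rw [hθ, zero_mul]

/-- Two mixing measures give the same integral to every polynomial function of degree at most `N`
on the simplex. -/
def MomentsAgree {V : ℕ} (G G₀ : MixingMeasure V) (N : ℕ) : Prop :=
  ∀ f ∈ coordSpan V ^ N, G.integral f = G₀.integral f

lemma MomentsAgree.symm {V : ℕ} {G G₀ : MixingMeasure V} {N : ℕ} (h : MomentsAgree G G₀ N) :
    MomentsAgree G₀ G N := fun f hf => (h f hf).symm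

/-- A polynomial function vanishing on the atoms of `G₀` vanishes on those of `G`: its square has
integral zero with respect to `G₀`, hence with respect to `G`. -/
lemma MomentsAgree.eq_zero_of_eq_zero {V : ℕ} {G G₀ : MixingMeasure V} {N d : ℕ}
    (h : MomentsAgree G G₀ N) (hd : d + d ≤ N) {f : Topic V → ℝ} (hf : f ∈ coordSpan V ^ d)
    (h0 : ∀ θ ∈ G₀.atoms, f θ = 0) : ∀ θ ∈ G.atoms, f θ = 0 := by
  have h1 := h (f * f) (mul_mem_coordSpan_pow hf hf hd)
  have h2 : G₀.integral (f * f) = 0 :=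
    Finset.sum_eq_zero fun θ hθ => by simp [h0 θ hθ]
  rw [h2, G.integral_apply, Finset.sum_eq_zero_iff_of_nonneg] at h1
  · intro θ hθ
    have := h1 θ hθ
    simpa [(MixingMeasure.weight_pos hθ).ne'] using this
  · intro θ _
    exact mul_nonneg (G.nonneg θ) (mul_self_nonneg (f θ))

/-- If every atom of either measure can be separated from all the others by a polynomial function
of degree at most `N`, then agreement of the moments of order `N` forces equality. -/
lemma MomentsAgree.eq_of_separated {V : ℕ} {G G₀ : MixingMeasure V} {N : ℕ}
    (h : MomentsAgree G G₀ N)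
    (hsep : ∀ θ, θ ∈ G.atoms ∨ θ ∈ G₀.atoms → ∃ f ∈ coordSpan V ^ N, f θ ≠ 0 ∧
      ∀ η, η ∈ G.atoms ∨ η ∈ G₀.atoms → η ≠ θ → f η = 0) : G = G₀ := by
  ext θ
  by_cases hθ : θ ∈ G.atoms ∨ θ ∈ G₀.atoms
  · obtain ⟨f, hf, hne, h0⟩ := hsep θ hθ
    have h1 := h f hf
    rw [G.integral_eq_single θ fun η hη => h0 η (Or.inl hη),
      G₀.integral_eq_single θ fun η hη => h0 η (Or.inr hη)] at h1
    exact mul_right_cancel₀ hne h1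
  · rw [not_or, MixingMeasure.mem_atoms, MixingMeasure.mem_atoms, not_not, not_not] at hθ
    rw [hθ.1, hθ.2]

/-! ### Separation of distinct topics -/

lemma exists_coordSpan_separating {V : ℕ} {θ η : Topic V} (h : η ≠ θ) :
    ∃ l ∈ coordSpan V, l θ ≠ 0 ∧ l η = 0 := by
  have h1 : ∃ v, η.1 v ≠ θ.1 v := by
    by_contra! hc
    exact h (Subtype.ext (funext hc))
  obtain ⟨v, hv⟩ := h1
  refine ⟨(fun θ : Topic V => θ.1 v) - η.1 v • 1,
    Submodule.sub_mem _ (coord_mem_coordSpan v) (Submodule.smul_mem _ _ (one_mem_coordSpan V)),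
    ?_, ?_⟩
  · simpa [sub_eq_zero] using hv.symm
  · simp

/-- A finite set of topics is cut out, away from a further topic, by a product of linear forms,
one for each of its points. -/
lemma exists_coordSpan_pow_separating {V : ℕ} (T : Finset (Topic V)) {θ : Topic V} (hθ : θ ∉ T) :
    ∃ f ∈ coordSpan V ^ T.card, f θ ≠ 0 ∧ ∀ η ∈ T, f η = 0 := by
  classical
  induction T using Finset.induction_on with
  | empty => exact ⟨1, by simp [Submodule.one_le.1], by simp, by simp⟩
  | insert a T ha ih =>
    rw [Finset.mem_insert, not_or] at hθ
    obtain ⟨f, hf, hne, h0⟩ := ih hθ.2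
    obtain ⟨l, hl, hlθ, hla⟩ := exists_coordSpan_separating (Ne.symm hθ.1)
    refine ⟨f * l, ?_, mul_ne_zero hne hlθ, fun η hη => ?_⟩
    · rw [Finset.card_insert_of_notMem ha, pow_succ]
      exact Submodule.mul_mem_mul hf hl
    · rcases Finset.mem_insert.1 hη with rfl | hη
      · simp [hla]
      · simp [h0 η hη]

/-- Agreement of the moments determines the measure once there are at most `N + 1` atoms in all. -/
lemma MomentsAgree.eq_of_card_union {V : ℕ} [DecidableEq (Topic V)] {G G₀ : MixingMeasure V}
    {N : ℕ} (h : MomentsAgree G G₀ N) (hc : (G.atoms ∪ G₀.atoms).card ≤ N + 1) : G = G₀ := by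
  refine h.eq_of_separated fun θ hθ => ?_
  obtain ⟨f, hf, hne, h0⟩ := exists_coordSpan_pow_separating
    ((G.atoms ∪ G₀.atoms).erase θ) (Finset.notMem_erase θ _)
  refine ⟨f, coordSpan_pow_mono ?_ hf, hne, fun η hη hηθ =>
    h0 η (Finset.mem_erase.2 ⟨hηθ, Finset.mem_union.2 hη⟩)⟩
  rw [Finset.card_erase_of_mem (Finset.mem_union.2 hθ)]
  omega

lemma MomentsAgree.eq_of_exactFitted {V : ℕ} {G G₀ : MixingMeasure V}
    (hc : G.atoms.card ≤ G₀.atoms.card) (h : MomentsAgree G G₀ (2 * G₀.atoms.card - 1)) :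
    G = G₀ := by
  classical
  refine h.eq_of_card_union ((Finset.card_union_le _ _).trans ?_)
  omega

/-- If the atoms of `G` are among those of `G₀`, agreement of moments of order at least
`K₀ - 1` determines the weights. -/
lemma MomentsAgree.eq_of_subset {V : ℕ} {G G₀ : MixingMeasure V} {N : ℕ}
    (h : MomentsAgree G G₀ N) (hs : G.atoms ⊆ G₀.atoms) (hc : G₀.atoms.card ≤ N + 1) :
    G = G₀ := by
  classical
  exact h.eq_of_card_union (by rwa [Finset.union_eq_right.2 hs])

lemma MomentsAgree.eq_of_overfitted {V : ℕ} {G G₀ : MixingMeasure V}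
    (h : MomentsAgree G G₀ (2 * G₀.atoms.card)) : G = G₀ := by
  refine h.eq_of_subset (fun θ hθ => ?_) (by omega)
  by_contra hθ0
  obtain ⟨f, hf, hne, h0⟩ := exists_coordSpan_pow_separating G₀.atoms hθ0
  exact hne (h.eq_zero_of_eq_zero (by omega) hf h0 θ hθ)

/-! ### The span of the atoms -/

/-- The linear span of the topics in a finite set. -/
noncomputable def topicSpan {V : ℕ} (A : Finset (Topic V)) : Submodule ℝ (Fin V → ℝ) :=
  Submodule.span ℝ ((fun θ : Topic V => θ.1) '' (A : Set (Topic V)))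

lemma mem_topicSpan {V : ℕ} {A : Finset (Topic V)} {θ : Topic V} (h : θ ∈ A) :
    θ.1 ∈ topicSpan A := Submodule.subset_span ⟨θ, h, rfl⟩

lemma topicSpan_le {V : ℕ} {A : Finset (Topic V)} {F : Submodule ℝ (Fin V → ℝ)} :
    topicSpan A ≤ F ↔ ∀ θ ∈ A, θ.1 ∈ F := by
  rw [topicSpan, Submodule.span_le]
  exact ⟨fun h θ hθ => h ⟨θ, hθ, rfl⟩, by rintro h _ ⟨θ, hθ, rfl⟩; exact h θ hθ⟩

/-- Linear forms vanishing on the span of one set of atoms vanish on the other, by positivity. -/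
lemma MomentsAgree.topicSpan_le {V : ℕ} {G G₀ : MixingMeasure V} {N : ℕ}
    (h : MomentsAgree G G₀ N) (hN : 2 ≤ N) : topicSpan G.atoms ≤ topicSpan G₀.atoms := by
  rw [_root_.topicSpan_le]
  intro θ hθ
  by_contra hn
  obtain ⟨l, hl, hl0⟩ := Submodule.exists_le_ker_of_notMem hn
  exact hl (h.eq_zero_of_eq_zero (d := 1) (by omega)
    (mem_coordSpan_pow_one (dual_mem_coordSpan l)) (fun η hη => hl0 (mem_topicSpan hη)) θ hθ)

lemma MomentsAgree.topicSpan_eq {V : ℕ} {G G₀ : MixingMeasure V} {N : ℕ}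
    (h : MomentsAgree G G₀ N) (hN : 2 ≤ N) : topicSpan G.atoms = topicSpan G₀.atoms :=
  le_antisymm (h.topicSpan_le hN) (h.symm.topicSpan_le hN)

lemma topicSpan_atoms {V : ℕ} (G : MixingMeasure V) :
    topicSpan G.atoms = Submodule.span ℝ (Set.range (topicVec G)) := by
  rw [topicSpan]
  congr 1
  ext x
  constructor
  · rintro ⟨θ, hθ, rfl⟩
    exact ⟨⟨θ, hθ⟩, rfl⟩
  · rintro ⟨θ, rfl⟩
    exact ⟨θ.1, θ.2, rfl⟩

/-- The coordinate forms of a linearly independent family. -/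
lemma LinearIndependent.exists_dual_family {ι E : Type*} [DecidableEq ι] [AddCommGroup E]
    [Module ℝ E] {v : ι → E} (hv : LinearIndependent ℝ v) :
    ∃ l : ι → E →ₗ[ℝ] ℝ, ∀ i j, l i (v j) = if i = j then 1 else 0 := by
  have h : ∀ i, ∃ l : E →ₗ[ℝ] ℝ, ∀ j, l (v j) = if i = j then 1 else 0 := by
    intro i
    obtain ⟨l, hl⟩ := LinearMap.exists_extend ((Module.Basis.span hv).coord i)
    refine ⟨l, fun j => ?_⟩
    have h1 := LinearMap.congr_fun hl (Module.Basis.span hv j)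
    rw [LinearMap.comp_apply, Submodule.subtype_apply,
      Module.Basis.coord_apply, Module.Basis.repr_self, Finsupp.single_apply,
      Module.Basis.span_apply] at h1
    rw [h1]
    simp only [eq_comm]
  choose l hl using h
  exact ⟨l, hl⟩

lemma topic_ne_zero {V : ℕ} (θ : Topic V) : θ.1 ≠ 0 := by
  intro h
  have := θ.2.2
  rw [h] at this
  simp at this

/-- A hyperplane that avoids a given point of the span of `A` and contains all but one element of
a basis of that span extracted from `A`. -/
lemma exists_dual_vanishing_on_basis {V : ℕ} (A : Finset (Topic V)) {θ : Topic V}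
    (hθ : θ.1 ∈ topicSpan A) :
    ∃ l : (Fin V → ℝ) →ₗ[ℝ] ℝ, l θ.1 ≠ 0 ∧
      Module.finrank ℝ (topicSpan A) ≤ (A.filter fun η => l η.1 = 0).card + 1 := by
  classical
  obtain ⟨κ, a, ha, hspan, hli⟩ := exists_linearIndependent' ℝ (fun η : A => η.1.1)
  have hA : topicSpan A = Submodule.span ℝ (Set.range ((fun η : A => η.1.1) ∘ a)) := by
    rw [hspan, topicSpan]
    congr 1
    ext x
    simp
  have : Finite κ := Finite.of_injective a ha
  have := Fintype.ofFinite κ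
  obtain ⟨l, hl⟩ := hli.exists_dual_family
  rw [hA] at hθ
  obtain ⟨c, hc⟩ := (Submodule.mem_span_range_iff_exists_fun ℝ).1 hθ
  have h1 : ∃ i, c i ≠ 0 := by
    by_contra! h0
    apply topic_ne_zero θ
    simp [← hc, h0]
  obtain ⟨i, hi⟩ := h1
  refine ⟨l i, ?_, ?_⟩
  · rw [← hc, map_sum]
    simp_rw [map_smul, hl]
    simpa using hi
  · rw [hA, finrank_span_eq_card hli]
    have h2 : ((Finset.univ.erase i).image fun j => (a j).1) ⊆ A.filter fun η => l i η.1 = 0 := by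
      intro η hη
      obtain ⟨j, hj, rfl⟩ := Finset.mem_image.1 hη
      refine Finset.mem_filter.2 ⟨(a j).2, ?_⟩
      rw [show (a j).1.1 = ((fun η : A => η.1.1) ∘ a) j from rfl, hl,
        if_neg (Finset.ne_of_mem_erase hj).symm]
    have h3 := Finset.card_le_card h2
    rw [Finset.card_image_of_injective (f := fun j => (a j).1) _ (Subtype.val_injective.comp ha),
      Finset.card_erase_of_mem (Finset.mem_univ i), Finset.card_univ] at h3
    omega

/-! ### Over-fitted identifiability from the rank -/

/-- Both sets of atoms span the same space, of dimension `R`; one hyperplane disposes of `R - 1`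
atoms of `G`, a second one of `R - 1` atoms of `G₀`, and the remaining atoms are treated
one by one. -/
lemma MomentsAgree.eq_of_rank {V : ℕ} {G G₀ : MixingMeasure V} {N : ℕ}
    (h : MomentsAgree G G₀ N) (hN : 2 ≤ N)
    (hc : G.atoms.card + G₀.atoms.card + 3 ≤ N + 2 * Module.finrank ℝ (topicSpan G₀.atoms)) :
    G = G₀ := by
  classical
  have hspan := h.topicSpan_eq hN
  refine h.eq_of_separated fun θ hθ => ?_
  have hθ1 : θ.1 ∈ topicSpan G₀.atoms := by
    rcases hθ with hθ | hθ
    · exact hspan ▸ mem_topicSpan hθ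
    · exact mem_topicSpan hθ
  obtain ⟨l, hl, hlc⟩ := exists_dual_vanishing_on_basis G.atoms (hspan ▸ hθ1)
  obtain ⟨l₀, hl₀, hlc₀⟩ := exists_dual_vanishing_on_basis G₀.atoms hθ1
  rw [hspan] at hlc
  set U := G.atoms.filter (fun η => ¬ l η.1 = 0) ∪ G₀.atoms.filter (fun η => ¬ l₀ η.1 = 0)
    with hU
  have hθU : θ ∈ U := by
    rcases hθ with hθ | hθ
    · exact Finset.mem_union_left _ (Finset.mem_filter.2 ⟨hθ, hl⟩)
    · exact Finset.mem_union_right _ (Finset.mem_filter.2 ⟨hθ, hl₀⟩)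
  obtain ⟨f, hf, hfθ, hf0⟩ := exists_coordSpan_pow_separating (U.erase θ)
    (Finset.notMem_erase θ _)
  have e1 := Finset.card_filter_add_card_filter_not (s := G.atoms) (fun η => l η.1 = 0)
  have e2 := Finset.card_filter_add_card_filter_not (s := G₀.atoms) (fun η => l₀ η.1 = 0)
  have e3 := Finset.card_union_le (G.atoms.filter (fun η => ¬ l η.1 = 0))
    (G₀.atoms.filter (fun η => ¬ l₀ η.1 = 0))
  rw [← hU] at e3
  have e4 := Finset.card_erase_of_mem hθU
  refine ⟨(fun η => l η.1) * (fun η => l₀ η.1) * f, mul_mem_coordSpan_pow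
    (mul_mem_coordSpan_pow (mem_coordSpan_pow_one (dual_mem_coordSpan l))
      (mem_coordSpan_pow_one (dual_mem_coordSpan l₀)) le_rfl) hf (by omega),
    mul_ne_zero (mul_ne_zero hl hl₀) hfθ, fun η hη hne => ?_⟩
  simp only [Pi.mul_apply]
  by_cases h1 : l η.1 = 0
  · simp [h1]
  by_cases h2 : l₀ η.1 = 0
  · simp [h2]
  rw [hf0 η (Finset.mem_erase.2 ⟨hne, ?_⟩), mul_zero]
  rcases hη with hη | hη
  · exact Finset.mem_union_left _ (Finset.mem_filter.2 ⟨hη, h1⟩)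
  · exact Finset.mem_union_right _ (Finset.mem_filter.2 ⟨hη, h2⟩)

/-! ### Linearly independent topics and anchor words -/

/-- A topic in the span of a linearly independent family of topics with at most one nonzero
coordinate is a member of the family: the coordinates sum to one. -/
lemma mem_of_dual_mul_eq_zero {V : ℕ} {A : Finset (Topic V)}
    {l : A → (Fin V → ℝ) →ₗ[ℝ] ℝ} (hl : ∀ i, l i i.1.1 ≠ 0)
    (hl0 : ∀ i j : A, i ≠ j → l i j.1.1 = 0)
    {θ : Topic V} (hθ : θ.1 ∈ topicSpan A) (hmul : ∀ i j, i ≠ j → l i θ.1 * l j θ.1 = 0) :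
    θ ∈ A := by
  classical
  have hA : topicSpan A = Submodule.span ℝ (Set.range fun η : A => η.1.1) := by
    rw [topicSpan]
    congr 1
    ext x
    simp
  rw [hA] at hθ
  obtain ⟨c, hc⟩ := (Submodule.mem_span_range_iff_exists_fun ℝ).1 hθ
  have hlc : ∀ i, l i θ.1 = c i * l i i.1.1 := by
    intro i
    rw [← hc, map_sum, Finset.sum_eq_single i]
    · simp
    · intro j _ hj
      rw [map_smul, hl0 i j hj.symm, smul_zero]
    · simp
  have h1 : ∃ i, c i ≠ 0 := by
    by_contra! h0
    apply topic_ne_zero θ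
    simp [← hc, h0]
  obtain ⟨i, hi⟩ := h1
  have h2 : ∀ j, j ≠ i → c j = 0 := by
    intro j hj
    have := hmul i j hj.symm
    rw [hlc, hlc] at this
    simpa [hi, hl] using this
  have h3 : θ.1 = c i • i.1.1 := by
    rw [← hc, Finset.sum_eq_single i]
    · intro j _ hj
      rw [h2 j hj, zero_smul]
    · simp
  have h4 : c i = 1 := by
    have e1 := θ.2.2
    rw [h3] at e1
    have e2 := i.1.2.2
    simp only [Pi.smul_apply, smul_eq_mul, ← Finset.mul_sum] at e1
    rw [e2, mul_one] at e1
    exact e1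
  rw [h4, one_smul] at h3
  rw [Subtype.ext h3]
  exact i.2

lemma MomentsAgree.eq_of_dual_mul_eq_zero {V : ℕ} {G G₀ : MixingMeasure V} {N : ℕ}
    (h : MomentsAgree G G₀ N) (hN : 2 ≤ N) {l : G₀.atoms → (Fin V → ℝ) →ₗ[ℝ] ℝ}
    (hl : ∀ i, l i i.1.1 ≠ 0) (hl0 : ∀ i j : G₀.atoms, i ≠ j → l i j.1.1 = 0)
    (hmul : ∀ θ ∈ G.atoms, ∀ i j, i ≠ j → l i θ.1 * l j θ.1 = 0) : G = G₀ := by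
  have hs : ∀ θ, θ ∈ G.atoms ∨ θ ∈ G₀.atoms → θ ∈ G₀.atoms := fun θ hθ =>
    hθ.elim (fun hθ => mem_of_dual_mul_eq_zero hl hl0
      (h.topicSpan_le hN (mem_topicSpan hθ)) (hmul θ hθ)) id
  refine h.eq_of_separated fun θ hθ => ⟨fun η => l ⟨θ, hs θ hθ⟩ η.1,
    coordSpan_pow_mono (by omega) (mem_coordSpan_pow_one (dual_mem_coordSpan _)),
    hl ⟨θ, hs θ hθ⟩, fun η hη hne => hl0 _ ⟨η, hs η hη⟩ fun he => hne ?_⟩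
  exact (congrArg Subtype.val he).symm

/-- The products of two distinct coordinate forms vanish at the atoms of `G₀`, hence, by positivity
in degree four, at those of `G`. -/
lemma MomentsAgree.eq_of_linearIndependent {V : ℕ} {G G₀ : MixingMeasure V}
    (h : MomentsAgree G G₀ 4) (hli : LinearIndependent ℝ (topicVec G₀)) : G = G₀ := by
  classical
  obtain ⟨l, hl⟩ := hli.exists_dual_family
  replace hl : ∀ i j : G₀.atoms, l i j.1.1 = if i = j then 1 else 0 := hl
  refine h.eq_of_dual_mul_eq_zero (by omega) (l := l) (fun i => by simp [hl])
    (fun i j hij => by simp [hl, hij]) fun θ hθ i j hij => ?_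
  refine h.eq_zero_of_eq_zero (d := 2) le_rfl
    (f := (fun η => l i η.1) * fun η => l j η.1)
    (mul_mem_coordSpan_pow (mem_coordSpan_pow_one (dual_mem_coordSpan _))
      (mem_coordSpan_pow_one (dual_mem_coordSpan _)) le_rfl) (fun η hη => ?_) θ hθ
  have e1 := hl i ⟨η, hη⟩
  have e2 := hl j ⟨η, hη⟩
  simp only [Pi.mul_apply, e1, e2]
  split_ifs with h1 h2
  · exact absurd (h1.trans h2.symm) hij
  all_goals simp

/-- The product of the coordinates of two anchor words is nonnegative on the simplex and vanishes
at the atoms of `G₀`, so that degree two suffices to see that it vanishes at those of `G`. -/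
lemma MomentsAgree.eq_of_anchorWord {V : ℕ} {G G₀ : MixingMeasure V}
    (h : MomentsAgree G G₀ 2) (ha : AnchorWord G₀) : G = G₀ := by
  choose v hv hv0 using ha
  refine h.eq_of_dual_mul_eq_zero le_rfl (l := fun i => LinearMap.proj (v i.1 i.2))
    (fun i => (hv i.1 i.2).ne')
    (fun i j hij => hv0 i.1 i.2 j.1 j.2 fun he => hij (Subtype.ext he.symm))
    fun θ hθ i j hij => ?_
  have h1 := h ((fun η => η.1 (v i.1 i.2)) * fun η => η.1 (v j.1 j.2))
    (mul_mem_coordSpan_pow (mem_coordSpan_pow_one (coord_mem_coordSpan _))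
      (mem_coordSpan_pow_one (coord_mem_coordSpan _)) le_rfl)
  have h2 : G₀.integral ((fun η => η.1 (v i.1 i.2)) * fun η => η.1 (v j.1 j.2)) = 0 := by
    refine Finset.sum_eq_zero fun η hη => ?_
    by_cases hi : η = i.1
    · have : η.1 (v j.1 j.2) = 0 := hv0 j.1 j.2 η hη fun he => hij (Subtype.ext (hi.symm.trans he))
      simp [this]
    · have : η.1 (v i.1 i.2) = 0 := hv0 i.1 i.2 η hη hi
      simp [this]
  rw [h2, G.integral_apply, Finset.sum_eq_zero_iff_of_nonneg] at h1
  · have := h1 θ hθ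
    simpa [(MixingMeasure.weight_pos hθ).ne'] using this
  · intro η _
    exact mul_nonneg (G.nonneg η) (mul_nonneg (η.2.1 _) (η.2.1 _))

/-! ### Exact-fitted identifiability from the Kruskal rank -/

/-- Any `k` topics of the finite set `A` are linearly independent. -/
def AllIndependent {V : ℕ} (A : Finset (Topic V)) (k : ℕ) : Prop :=
  ∀ S ⊆ A, S.card = k → LinearIndependent ℝ fun θ : S => θ.1.1

/-- A hyperplane through any `k - 1` prescribed members of `A` can be made to avoid a further
one. -/
lemma AllIndependent.exists_dual {V : ℕ} {A : Finset (Topic V)} {k : ℕ}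
    (hA : AllIndependent A k) (hk : k ≤ A.card) {θ : Topic V} (hθ : θ ∈ A)
    {T : Finset (Topic V)} (hT : T ⊆ A) (hθT : θ ∉ T) (hc : T.card + 1 ≤ k) :
    ∃ l : (Fin V → ℝ) →ₗ[ℝ] ℝ, l θ.1 ≠ 0 ∧ ∀ η ∈ T, l η.1 = 0 := by
  classical
  obtain ⟨S, hTS, hSA, hS⟩ := Finset.exists_subsuperset_card_eq
    (Finset.insert_subset hθ hT) (by rwa [Finset.card_insert_of_notMem hθT]) hk
  obtain ⟨l, hl⟩ := (hA S hSA hS).exists_dual_family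
  have hθS : θ ∈ S := hTS (Finset.mem_insert_self _ _)
  refine ⟨l ⟨θ, hθS⟩, ?_, fun η hη => ?_⟩
  · have := hl ⟨θ, hθS⟩ ⟨θ, hθS⟩
    simp only [if_true] at this
    rw [this]
    exact one_ne_zero
  · have := hl ⟨θ, hθS⟩ ⟨η, hTS (Finset.mem_insert_of_mem hη)⟩
    rw [if_neg] at this
    · exact this
    · intro he
      have he' : θ = η := congrArg Subtype.val he
      exact hθT (he' ▸ hη)

/-- Products of `s` linear forms cut out any `s * (k - 1)` prescribed members of `A` away from a
further one. -/
lemma AllIndependent.exists_coordSpan_pow {V : ℕ} {A : Finset (Topic V)} {k : ℕ}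
    (hA : AllIndependent A k) (hk : k ≤ A.card) (hk1 : 1 ≤ k) {θ : Topic V} (hθ : θ ∈ A) (s : ℕ)
    {T : Finset (Topic V)} (hT : T ⊆ A) (hθT : θ ∉ T) (hc : T.card ≤ s * (k - 1)) :
    ∃ f ∈ coordSpan V ^ s, f θ ≠ 0 ∧ ∀ η ∈ T, f η = 0 := by
  classical
  induction s generalizing T with
  | zero =>
    have : T = ∅ := by simpa using hc
    subst this
    exact ⟨1, by simp [Submodule.one_le.1], by simp, by simp⟩
  | succ s ih =>
    obtain ⟨T₁, hT₁, hc₁⟩ := Finset.exists_subset_card_eq (min_le_left T.card (k - 1))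
    have e := Finset.card_sdiff_of_subset hT₁
    rw [add_mul, one_mul] at hc
    obtain ⟨f, hf, hfθ, hf0⟩ := ih (T := T \ T₁) (Finset.sdiff_subset.trans hT)
      (fun h => hθT (Finset.sdiff_subset h)) (by omega)
    obtain ⟨l, hl, hl0⟩ := hA.exists_dual hk hθ (hT₁.trans hT) (fun h => hθT (hT₁ h)) (by omega)
    refine ⟨f * fun η => l η.1, ?_, mul_ne_zero hfθ hl, fun η hη => ?_⟩
    · rw [pow_succ]
      exact Submodule.mul_mem_mul hf (dual_mem_coordSpan l)
    · by_cases h1 : η ∈ T₁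
      · simp [hl0 η h1]
      · simp [hf0 η (Finset.mem_sdiff.2 ⟨hη, h1⟩)]

/-- More functions than points: a nontrivial linear combination of the functions vanishes on all
the points. -/
lemma exists_linearCombination_eq_zero {X : Type*} (P U : Finset X) (f : X → X → ℝ)
    (h : P.card < U.card) :
    ∃ c : X → ℝ, (∃ η ∈ U, c η ≠ 0) ∧ ∀ x ∈ P, ∑ η ∈ U, c η * f η x = 0 := by
  classical
  have h1 : ¬ LinearIndependent ℝ fun (η : U) (x : P) => f η.1 x.1 := by
    intro hli
    have := hli.fintype_card_le_finrank
    rw [Module.finrank_fintype_fun_eq_card] at this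
    simp only [Fintype.card_coe] at this
    omega
  obtain ⟨g, hg, i, hi⟩ := Fintype.not_linearIndependent_iff.1 h1
  refine ⟨fun η => if hη : η ∈ U then g ⟨η, hη⟩ else 0, ⟨i.1, i.2, by simpa using hi⟩,
    fun x hx => ?_⟩
  have h2 := congrFun hg ⟨x, hx⟩
  rw [← Finset.sum_coe_sort]
  simpa [Finset.sum_apply] using h2

/-- The hypothesis of Kruskal's permutation lemma. A hyperplane missing `m ≤ K₀ + 1 - k` atoms of
`G` misses at most `m` atoms of `G₀`. If it missed more, then among `m + 1` functions of degree
`t`, each separating one missed atom of `G₀` from many others, some combination `f` would kill all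
missed atoms of `G`; multiplied by the hyperplane and by a product `u` of further forms that kills
the remaining missed atoms of `G₀`, it would see one single atom, of `G₀`. -/
lemma MomentsAgree.card_filter_le {V : ℕ} {G G₀ : MixingMeasure V} {N k : ℕ}
    (h : MomentsAgree G G₀ N) (hA : AllIndependent G₀.atoms k) (hk : k ≤ G₀.atoms.card)
    (hk2 : 2 ≤ k) (hN : 2 * G₀.atoms.card - 1 ≤ N * (k - 1)) (l : (Fin V → ℝ) →ₗ[ℝ] ℝ)
    (hm : (G.atoms.filter fun η => l η.1 ≠ 0).card + k ≤ G₀.atoms.card + 1) :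
    (G₀.atoms.filter fun η => l η.1 ≠ 0).card ≤ (G.atoms.filter fun η => l η.1 ≠ 0).card := by
  classical
  set P := G.atoms.filter fun η => l η.1 ≠ 0 with hP
  set Q := G₀.atoms.filter fun η => l η.1 ≠ 0 with hQ
  have hQA : Q ⊆ G₀.atoms := Finset.filter_subset _ _
  have hQc : Q.card ≤ G₀.atoms.card := Finset.card_le_card hQA
  by_contra! hlt
  obtain ⟨r, rfl⟩ : ∃ r, k = r + 1 := ⟨k - 1, by omega⟩
  rw [Nat.add_sub_cancel] at hN
  -- the least `t` with `P.card ≤ t * r`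
  obtain ⟨t, ht1, ht2⟩ : ∃ t, P.card ≤ t * r ∧ t * r + 1 ≤ P.card + r := by
    have e1 := Nat.div_add_mod (P.card + r - 1) r
    have e2 := Nat.mod_lt (P.card + r - 1) (show r > 0 by omega)
    rw [mul_comm] at e1
    exact ⟨(P.card + r - 1) / r, by omega, by omega⟩
  have htN : t + 1 ≤ N := by
    have : t * r < N * r := by omega
    exact Nat.lt_of_mul_lt_mul_right this
  obtain ⟨s, rfl⟩ := Nat.exists_eq_add_of_le htN
  have hmul : (t + 1 + s) * r = t * r + r + s * r := by ring
  rw [hmul] at hN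
  obtain ⟨U, hUQ, hUc⟩ := Finset.exists_subset_card_eq (show P.card + 1 ≤ Q.card by omega)
  have eU := Finset.card_sdiff_of_subset hUQ
  obtain ⟨U', hU', hUc'⟩ := Finset.exists_subset_card_eq
    (min_le_left (Q \ U).card (t * r - P.card))
  have hdisj : Disjoint U U' := (Finset.disjoint_sdiff (s := U) (t := Q)).mono_right hU'
  have hUU : U ∪ U' ⊆ Q := Finset.union_subset hUQ (hU'.trans Finset.sdiff_subset)
  have hf : ∀ η ∈ U, ∃ f ∈ coordSpan V ^ t, f η ≠ 0 ∧ ∀ ξ ∈ (U ∪ U').erase η, f ξ = 0 := by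
    intro η hη
    refine hA.exists_coordSpan_pow hk (by omega) (hQA (hUQ hη)) t
      ((Finset.erase_subset _ _).trans (hUU.trans hQA)) (Finset.notMem_erase _ _) ?_
    rw [Finset.card_erase_of_mem (Finset.mem_union_left _ hη), Finset.card_union_of_disjoint hdisj,
      Nat.add_sub_cancel]
    omega
  choose! f hfm hfη hf0 using hf
  obtain ⟨c, ⟨θ, hθ, hcθ⟩, hc0⟩ := exists_linearCombination_eq_zero P U f (by omega)
  have hθQ : θ ∈ Q := hUQ hθ
  have eR := Finset.card_sdiff_of_subset (hU'.trans (Finset.sdiff_subset (s := Q) (t := U)))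
  have hθR : θ ∈ Q \ U' := Finset.mem_sdiff.2 ⟨hθQ, Finset.disjoint_left.1 hdisj hθ⟩
  have eR' := Finset.card_erase_of_mem hθR
  obtain ⟨u, hum, huθ, hu0⟩ := hA.exists_coordSpan_pow hk (by omega) (hQA hθQ) s
    (T := (Q \ U').erase θ) ((Finset.erase_subset _ _).trans (Finset.sdiff_subset.trans hQA))
    (Finset.notMem_erase _ _) (by rw [Nat.add_sub_cancel]; omega)
  set w : Topic V → ℝ := ∑ η ∈ U, c η • f η with hw
  have hwm : w ∈ coordSpan V ^ t :=
    Submodule.sum_mem _ fun η hη => Submodule.smul_mem _ _ (hfm η hη)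
  have hwa : ∀ x, w x = ∑ η ∈ U, c η * f η x := fun x => by simp [hw]
  have hwθ : w θ ≠ 0 := by
    rw [hwa, Finset.sum_eq_single θ]
    · exact mul_ne_zero hcθ (hfη θ hθ)
    · intro η hη hne
      rw [hf0 η hη θ (Finset.mem_erase.2 ⟨hne.symm, Finset.mem_union_left _ hθ⟩), mul_zero]
    · exact fun hn => absurd hθ hn
  have hwU : ∀ x ∈ U', w x = 0 := by
    intro x hx
    rw [hwa]
    refine Finset.sum_eq_zero fun η hη => ?_
    rw [hf0 η hη x (Finset.mem_erase.2 ⟨?_, Finset.mem_union_right _ hx⟩), mul_zero]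
    rintro rfl
    exact Finset.disjoint_left.1 hdisj hη hx
  have hg := h (w * (fun η => l η.1) * u) (mul_mem_coordSpan_pow
    (mul_mem_coordSpan_pow hwm (mem_coordSpan_pow_one (dual_mem_coordSpan l)) le_rfl) hum le_rfl)
  rw [G₀.integral_eq_single θ] at hg
  · have h0 : G.integral (w * (fun η => l η.1) * u) = 0 := by
      refine Finset.sum_eq_zero fun η hη => ?_
      by_cases h1 : l η.1 = 0
      · simp [h1]
      · have : w η = 0 := by rw [hwa]; exact hc0 η (Finset.mem_filter.2 ⟨hη, h1⟩)
        simp [this]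
    rw [h0] at hg
    exact mul_ne_zero (MixingMeasure.weight_pos (hQA hθQ)).ne'
      (mul_ne_zero (mul_ne_zero hwθ (Finset.mem_filter.1 hθQ).2) huθ) hg.symm
  · intro η hη hne
    simp only [Pi.mul_apply]
    by_cases h1 : l η.1 = 0
    · simp [h1]
    by_cases h2 : η ∈ U'
    · simp [hwU η h2]
    · rw [hu0 η, mul_zero]
      exact Finset.mem_erase.2 ⟨hne, Finset.mem_sdiff.2 ⟨Finset.mem_filter.2 ⟨hη, h1⟩, h2⟩⟩

/-- Kruskal's permutation lemma, for subspaces: if every hyperplane of `W` spanned by points of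
`A` misses at most as many points of `B` as of `A`, then so does every proper subspace spanned by
points of `A`. For the induction on the codimension, the subspaces spanned by `F` and one more point
of `A` cut the points of `A` outside `F` into classes, and the points of `B` outside `F` into
classes and a rest. -/
lemma card_filter_notMem_le_of_hyperplanes {E : Type*} [AddCommGroup E] [Module ℝ E]
    [FiniteDimensional ℝ E] (W : Submodule ℝ E) (A B : Finset E)
    [∀ F : Submodule ℝ E, DecidablePred (· ∈ F)]
    (hA : Submodule.span ℝ (A : Set E) = W)
    (hyp : ∀ F : Submodule ℝ E, (∃ T ⊆ A, F = Submodule.span ℝ (T : Set E)) →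
      Module.finrank ℝ F + 1 = Module.finrank ℝ W →
      (B.filter (· ∉ F)).card ≤ (A.filter (· ∉ F)).card)
    (T : Finset E) (hT : T ⊆ A) (hTW : Submodule.span ℝ (T : Set E) ≠ W) :
    (B.filter (· ∉ Submodule.span ℝ (T : Set E))).card
      ≤ (A.filter (· ∉ Submodule.span ℝ (T : Set E))).card := by
  classical
  have key : ∀ n, ∀ T ⊆ A, Submodule.span ℝ (T : Set E) ≠ W →
      Module.finrank ℝ W ≤ Module.finrank ℝ (Submodule.span ℝ (T : Set E)) + n →
      (B.filter (· ∉ Submodule.span ℝ (T : Set E))).card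
      ≤ (A.filter (· ∉ Submodule.span ℝ (T : Set E))).card := by
    intro n
    induction n with
    | zero =>
      intro T hT hne hr
      refine absurd (Submodule.eq_of_le_of_finrank_le ?_ hr) hne
      rw [← hA]
      exact Submodule.span_mono (by exact_mod_cast hT)
    | succ n ih =>
      intro T hT hne hr
      set F := Submodule.span ℝ (T : Set E) with hF
      have hFW : F ≤ W := by
        rw [← hA]
        exact Submodule.span_mono (by exact_mod_cast hT)
      have hlt : Module.finrank ℝ F < Module.finrank ℝ W :=
        Submodule.finrank_lt_finrank_of_lt (lt_of_le_of_ne hFW hne)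
      by_cases h1 : Module.finrank ℝ F + 1 = Module.finrank ℝ W
      · exact hyp F ⟨T, hT, hF⟩ h1
      -- the flats covering `F`
      set fl : E → Submodule ℝ E := fun a => F ⊔ Submodule.span ℝ {a} with hfl
      have hfl' : ∀ a, fl a = Submodule.span ℝ ((insert a T : Finset E) : Set E) := by
        intro a
        rw [Finset.coe_insert, Submodule.span_insert, sup_comm]
      have hmem : ∀ a, a ∈ fl a := fun a =>
        Submodule.mem_sup_right (Submodule.mem_span_singleton_self a)
      have hrk : ∀ a ∉ F, Module.finrank ℝ (fl a) = Module.finrank ℝ F + 1 := by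
        intro a ha
        have e1 : Module.finrank ℝ F < Module.finrank ℝ (fl a) := by
          refine Submodule.finrank_lt_finrank_of_lt (lt_of_le_of_ne le_sup_left fun he => ha ?_)
          rw [he]; exact hmem a
        have e2 := Submodule.finrank_add_le_finrank_add_finrank F (Submodule.span ℝ {a})
        have e3 := finrank_span_singleton (K := ℝ)
            (v := a) (fun h0 => ha (h0 ▸ F.zero_mem))
        exact le_antisymm (e2.trans_eq (by rw [e3])) e1
      -- two distinct flats meet in `F`
      have huniq : ∀ a ∉ F, ∀ x ∉ F, x ∈ fl a → fl a = fl x := by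
        intro a ha x hx hxa
        refine (Submodule.eq_of_le_of_finrank_eq ?_ ?_).symm
        · exact sup_le le_sup_left ((Submodule.span_singleton_le_iff_mem _ _).2 hxa)
        · rw [hrk a ha, hrk x hx]
      set A' := A.filter (· ∉ F) with hA'
      set B' := B.filter (· ∉ F) with hB'
      set 𝓕 := A'.image fl with h𝓕
      have hA'F : ∀ a ∈ A', a ∉ F := fun a ha => (Finset.mem_filter.1 ha).2
      have hfi : ∀ H ∈ 𝓕, (B.filter (· ∉ H)).card ≤ (A.filter (· ∉ H)).card := by
        intro H hH
        obtain ⟨a, ha, rfl⟩ := Finset.mem_image.1 hH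
        have hr' := hrk a (hA'F a ha)
        rw [hfl'] at hr' ⊢
        refine ih _ (Finset.insert_subset (Finset.mem_filter.1 ha).1 hT) (fun he => ?_) ?_
        · rw [he] at hr'
          omega
        · omega
      have hle : ∀ H ∈ 𝓕, F ≤ H := by
        intro H hH
        obtain ⟨a, _, rfl⟩ := Finset.mem_image.1 hH
        exact le_sup_left
      have hcard : ∀ C : Finset E, ∑ H ∈ 𝓕, (C.filter (· ∉ H)).card
          = ∑ x ∈ C.filter (· ∉ F), (𝓕.filter fun H => x ∉ H).card := by
        intro C
        simp_rw [Finset.card_filter]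
        rw [Finset.sum_comm, Finset.sum_filter]
        refine Finset.sum_congr rfl fun x _ => ?_
        split_ifs with hx
        · exact Finset.sum_eq_zero fun H hH => if_neg (not_not.2 (hle H hH hx))
        · rfl
      have hone : ∀ x ∉ F, 𝓕.filter (fun H => x ∈ H) ⊆ {fl x} := by
        intro x hx H hH
        obtain ⟨hH, hxH⟩ := Finset.mem_filter.1 hH
        obtain ⟨a, ha, rfl⟩ := Finset.mem_image.1 hH
        exact Finset.mem_singleton.2 (huniq a (hA'F a ha) x hx hxH)
      have hsumA : ∑ H ∈ 𝓕, (A.filter (· ∉ H)).card = A'.card * (𝓕.card - 1) := by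
        rw [hcard, Finset.sum_const_nat]
        intro x hx
        have e1 : 𝓕.filter (fun H => x ∈ H) = {fl x} := by
          refine Finset.Subset.antisymm (hone x (hA'F x hx)) (Finset.singleton_subset_iff.2 ?_)
          exact Finset.mem_filter.2 ⟨Finset.mem_image_of_mem fl hx, hmem x⟩
        have e2 := Finset.card_filter_add_card_filter_not (s := 𝓕) (fun H => x ∈ H)
        rw [e1, Finset.card_singleton] at e2
        omega
      have hsumB : B'.card * (𝓕.card - 1) ≤ ∑ H ∈ 𝓕, (B.filter (· ∉ H)).card := by
        rw [hcard, ← smul_eq_mul]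
        refine Finset.card_nsmul_le_sum _ _ _ fun x hx => ?_
        have e1 := Finset.card_le_card (hone x (Finset.mem_filter.1 hx).2)
        have e2 := Finset.card_filter_add_card_filter_not (s := 𝓕) (fun H => x ∈ H)
        rw [Finset.card_singleton] at e1
        omega
      have h2 : 1 < 𝓕.card := by
        by_contra! hc
        rcases A'.eq_empty_or_nonempty with he | ⟨a, ha⟩
        · refine hne (le_antisymm hFW ?_)
          rw [← hA, Submodule.span_le]
          intro x hx
          by_contra hxF
          exact Finset.notMem_empty x (he ▸ Finset.mem_filter.2 ⟨hx, hxF⟩)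
        · have hWa : W ≤ fl a := by
            rw [← hA, Submodule.span_le]
            intro x hx
            by_cases hxF : x ∈ F
            · exact Submodule.mem_sup_left hxF
            · have hx' : x ∈ A' := Finset.mem_filter.2 ⟨hx, hxF⟩
              rw [Finset.card_le_one.1 hc (fl a) (Finset.mem_image_of_mem fl ha) (fl x)
                (Finset.mem_image_of_mem fl hx')]
              exact hmem x
          have e1 := Submodule.finrank_mono hWa
          rw [hrk a (hA'F a ha)] at e1
          omega
      have h3 : B'.card * (𝓕.card - 1) ≤ A'.card * (𝓕.card - 1) :=
        hsumB.trans ((Finset.sum_le_sum hfi).trans hsumA.le)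
      exact Nat.le_of_mul_le_mul_right h3 (by omega)
  exact key _ T hT hTW (Nat.le_add_left _ _)

/-- Kruskal's theorem for symmetric tensors with positive weights, of which only one of the two
decompositions has controlled Kruskal rank. -/
lemma MomentsAgree.eq_of_allIndependent {V : ℕ} {G G₀ : MixingMeasure V} {N k : ℕ}
    (h : MomentsAgree G G₀ N) (hc : G.atoms.card ≤ G₀.atoms.card)
    (hA : AllIndependent G₀.atoms k) (hk : k ≤ G₀.atoms.card)
    (hk2 : 2 ≤ k) (hN : 2 * G₀.atoms.card - 1 ≤ N * (k - 1)) : G = G₀ := by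
  classical
  have hN2 : 2 ≤ N := by
    by_contra! hlt
    have : N * (k - 1) ≤ 1 * (k - 1) := Nat.mul_le_mul_right _ (by omega)
    omega
  have hspan := h.topicSpan_eq hN2
  have hRk : k ≤ Module.finrank ℝ (topicSpan G₀.atoms) := by
    obtain ⟨S, hSA, hS⟩ := Finset.exists_subset_card_eq hk
    have hli := hA S hSA hS
    have e1 := finrank_span_eq_card hli
    rw [Fintype.card_coe, hS] at e1
    rw [← e1]
    refine Submodule.finrank_mono (Submodule.span_le.2 ?_)
    rintro _ ⟨θ, rfl⟩
    exact mem_topicSpan (hSA θ.2)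
  have hval : Function.Injective fun θ : Topic V => θ.1 := Subtype.val_injective
  set A : Finset (Fin V → ℝ) := G.atoms.image fun θ => θ.1 with hAdef
  set B : Finset (Fin V → ℝ) := G₀.atoms.image fun θ => θ.1 with hBdef
  have hspanA : Submodule.span ℝ (A : Set (Fin V → ℝ)) = topicSpan G.atoms := by
    rw [topicSpan, hAdef, Finset.coe_image]
  have hfilA : ∀ F : Submodule ℝ (Fin V → ℝ), (A.filter (· ∉ F)).card
      = (G.atoms.filter fun θ => θ.1 ∉ F).card := fun F => by
    rw [hAdef, Finset.filter_image, Finset.card_image_of_injective _ hval]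
  have hfilB : ∀ F : Submodule ℝ (Fin V → ℝ), (B.filter (· ∉ F)).card
      = (G₀.atoms.filter fun θ => θ.1 ∉ F).card := fun F => by
    rw [hBdef, Finset.filter_image, Finset.card_image_of_injective _ hval]
  have hperm := card_filter_notMem_le_of_hyperplanes (topicSpan G.atoms) A B hspanA (by
    rintro F ⟨T, hTA, rfl⟩ hr
    set F := Submodule.span ℝ (T : Set (Fin V → ℝ)) with hF
    have hFW : F ≤ topicSpan G.atoms := by
      rw [← hspanA]
      exact Submodule.span_mono (by exact_mod_cast hTA)
    -- a form cutting out `F` inside the span of the atoms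
    obtain ⟨x, hx, hxF⟩ : ∃ x ∈ topicSpan G.atoms, x ∉ F := by
      by_contra! hcon
      rw [le_antisymm hFW hcon] at hr
      omega
    obtain ⟨l, hlx, hlF⟩ := Submodule.exists_le_ker_of_notMem hxF
    have hker : ∀ y ∈ topicSpan G.atoms, (y ∉ F ↔ l y ≠ 0) := by
      intro y hy
      refine not_congr ⟨fun hyF => hlF hyF, fun hly => ?_⟩
      have e1 : F = topicSpan G.atoms ⊓ LinearMap.ker l := by
        refine Submodule.eq_of_le_of_finrank_le (le_inf hFW hlF) ?_
        have e2 : topicSpan G.atoms ⊓ LinearMap.ker l < topicSpan G.atoms := by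
          refine lt_of_le_of_ne inf_le_left fun he => hlx ?_
          have : x ∈ topicSpan G.atoms ⊓ LinearMap.ker l := by rw [he]; exact hx
          exact this.2
        have e3 := Submodule.finrank_lt_finrank_of_lt e2
        omega
      rw [e1]
      exact ⟨hy, hly⟩
    have hGf : (G.atoms.filter fun θ => θ.1 ∉ F) = G.atoms.filter fun θ => l θ.1 ≠ 0 :=
      Finset.filter_congr fun θ hθ => hker _ (mem_topicSpan hθ)
    have hG₀f : (G₀.atoms.filter fun θ => θ.1 ∉ F) = G₀.atoms.filter fun θ => l θ.1 ≠ 0 :=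
      Finset.filter_congr fun θ hθ => hker _ (hspan ▸ mem_topicSpan hθ)
    rw [hfilA, hfilB, hG₀f, hGf]
    refine h.card_filter_le hA hk hk2 hN l ?_
    rw [← hGf, ← hfilA]
    have e1 : T.card ≤ (A.filter (· ∈ F)).card := Finset.card_le_card fun y hy =>
      Finset.mem_filter.2 ⟨hTA hy, Submodule.subset_span hy⟩
    have e2 := finrank_span_finset_le_card (R := ℝ) T
    have e3 := Finset.card_filter_add_card_filter_not (s := A) (fun y => y ∈ F)
    have e4 : A.card = G.atoms.card := Finset.card_image_of_injective _ hval
    rw [← hspan] at hRk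
    change Module.finrank ℝ F ≤ _ at e2
    omega)
  have hs : G.atoms ⊆ G₀.atoms := by
    intro θ hθ
    by_contra hθ₀
    have h1 := hperm {θ.1} (Finset.singleton_subset_iff.2 (Finset.mem_image_of_mem _ hθ)) (by
      intro he
      have e1 := finrank_span_singleton (K := ℝ) (topic_ne_zero θ)
      rw [Finset.coe_singleton] at he
      rw [he, hspan] at e1
      omega)
    rw [hfilA, hfilB, Finset.coe_singleton] at h1
    have h2 : G₀.atoms.filter (fun η => η.1 ∉ Submodule.span ℝ {θ.1}) = G₀.atoms := by
      refine Finset.filter_true_of_mem fun η hη hmem => hθ₀ ?_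
      obtain ⟨c, hc⟩ := Submodule.mem_span_singleton.1 hmem
      have e1 := η.2.2
      have e2 := θ.2.2
      rw [← hc] at e1
      simp only [Pi.smul_apply, smul_eq_mul, ← Finset.mul_sum] at e1
      rw [e2, mul_one] at e1
      rw [e1, one_smul] at hc
      rw [Subtype.ext hc]
      exact hη
    have h3 : (G.atoms.filter fun η => η.1 ∉ Submodule.span ℝ {θ.1}).card < G.atoms.card := by
      refine Finset.card_lt_card ((Finset.filter_ssubset).2 ⟨θ, hθ, ?_⟩)
      exact not_not.2 (Submodule.mem_span_singleton_self _)
    rw [h2] at h1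
    omega
  have hs' : ∀ θ, θ ∈ G.atoms ∨ θ ∈ G₀.atoms → θ ∈ G₀.atoms := fun θ hθ => hθ.elim (@hs θ) id
  refine h.eq_of_separated fun θ hθ => ?_
  obtain ⟨f, hf, hfθ, hf0⟩ := hA.exists_coordSpan_pow hk (by omega) (hs' θ hθ) N
    (Finset.erase_subset θ _) (Finset.notMem_erase θ _) (by
      rw [Finset.card_erase_of_mem (hs' θ hθ)]
      omega)
  exact ⟨f, hf, hfθ, fun η hη hne => hf0 η (Finset.mem_erase.2 ⟨hne, hs' η hη⟩)⟩

lemma kruskalRank_spec {ι E : Type*} [Fintype ι] [AddCommGroup E] [Module ℝ E] (v : ι → E) :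
    kruskalRank v ≤ Fintype.card ι ∧
      ∀ S : Finset ι, S.card = kruskalRank v → LinearIndependent ℝ fun i : S => v i := by
  have h : kruskalRank v ∈ {r : ℕ | r ≤ Fintype.card ι ∧
      ∀ S : Finset ι, S.card = r → LinearIndependent ℝ fun i : S => v i} := by
    refine Nat.sSup_mem ⟨0, Nat.zero_le _, fun S hS => ?_⟩ ⟨Fintype.card ι, fun r hr => hr.1⟩
    rw [Finset.card_eq_zero] at hS
    subst hS
    exact linearIndependent_empty_type
  exact h

lemma allIndependent_kruskalRank {V : ℕ} (G : MixingMeasure V) :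
    AllIndependent G.atoms (kruskalRank (topicVec G)) := by
  classical
  intro S hS hc
  have h := (kruskalRank_spec (topicVec G)).2 (S.subtype (· ∈ G.atoms)) (by
    rw [Finset.card_subtype, Finset.filter_true_of_mem fun θ hθ => hS hθ, hc])
  exact h.comp (fun θ : S => (⟨⟨θ.1, hS θ.2⟩, Finset.mem_subtype.2 θ.2⟩ :
    S.subtype (· ∈ G.atoms))) fun θ η he => by
      exact Subtype.ext (congrArg (fun x => x.1.1) he)

lemma AllIndependent.of_linearIndependent {V : ℕ} {G : MixingMeasure V}
    (h : LinearIndependent ℝ (topicVec G)) (k : ℕ) : AllIndependent G.atoms k :=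
  fun S hS _ => h.comp (fun θ : S => ⟨θ.1, hS θ.2⟩) fun _ _ he =>
    Subtype.ext (congrArg (fun η : G.atoms => η.1) he)

/-- Distinct topics are pairwise non-proportional, as their coordinates sum to one. -/
lemma two_le_kruskalRank {V : ℕ} {G : MixingMeasure V} (h : 2 ≤ G.atoms.card) :
    2 ≤ kruskalRank (topicVec G) := by
  classical
  refine le_csSup ⟨Fintype.card G.atoms, fun r hr => hr.1⟩ ⟨by simpa using h, fun S hS => ?_⟩
  obtain ⟨a, b, hab, rfl⟩ := Finset.card_eq_two.1 hS
  rw [Fintype.linearIndependent_iff]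
  intro g hg
  have key : ∀ x y : ℝ, x • (a.1.1 : Fin V → ℝ) + y • b.1.1 = 0 → x = 0 ∧ y = 0 := by
    intro x y hxy
    obtain ⟨v, hv⟩ : ∃ v, a.1.1 v ≠ b.1.1 v := by
      by_contra! hc
      exact hab (Subtype.ext (Subtype.ext (funext hc)))
    have e1 : x + y = 0 := by
      have := congrArg (fun z : Fin V → ℝ => ∑ v, z v) hxy
      simp only [Pi.add_apply, Pi.smul_apply, smul_eq_mul, Finset.sum_add_distrib,
        ← Finset.mul_sum, Pi.zero_apply, Finset.sum_const_zero] at this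
      have ha := a.1.2.2
      have hb := b.1.2.2
      rw [ha, hb] at this
      linarith
    have e2 := congrFun hxy v
    simp only [Pi.add_apply, Pi.smul_apply, smul_eq_mul, Pi.zero_apply] at e2
    have hx : x * (a.1.1 v - b.1.1 v) = 0 := by
      have : y = -x := by linarith
      rw [this] at e2
      linarith
    have hx0 : x = 0 := (mul_eq_zero.1 hx).resolve_right (sub_ne_zero.2 hv)
    exact ⟨hx0, by linarith⟩
  have ha : a ∈ ({a, b} : Finset G.atoms) := by simp
  have hb : b ∈ ({a, b} : Finset G.atoms) := by simp
  have h1 := key (g ⟨a, ha⟩) (g ⟨b, hb⟩) (by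
    rw [← hg, ← Finset.attach_eq_univ]
    rw [Finset.sum_eq_add_of_mem (⟨a, ha⟩ : ({a, b} : Finset G.atoms)) ⟨b, hb⟩
      (Finset.mem_attach _ _) (Finset.mem_attach _ _) (fun he => hab (congrArg Subtype.val he))]
    · rfl
    · rintro ⟨c, hc⟩ _ ⟨hca, hcb⟩
      rcases Finset.mem_insert.1 hc with rfl | hc
      · exact absurd rfl hca
      · rw [Finset.mem_singleton] at hc
        subst hc
        exact absurd rfl hcb)
  rintro ⟨c, hc⟩
  rcases Finset.mem_insert.1 hc with rfl | hc'
  · exact h1.1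
  · rw [Finset.mem_singleton] at hc'
    subst hc'
    exact h1.2

/-! ### Moments of the Dirichlet distribution -/

/-- How often the value `k` occurs in the sequence `z`. -/
def occurrences {ι : Type*} [DecidableEq ι] {n : ℕ} (z : Fin n → ι) (k : ι) : ℕ :=
  (Finset.univ.filter fun i => z i = k).card

/-- The Pólya urn weight of a sequence of colours, when colour `k` has initial mass `a k`: the
product of the rising factorials of the initial masses `a k` up to the numbers of occurrences. It is
the moment `𝔼 ∏_i g_{z i}` of independent Gamma variables of shapes `a k` and rate one. -/
noncomputable def urnWeight {ι : Type*} [Fintype ι] [DecidableEq ι] (a : ι → ℝ) {n : ℕ}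
    (z : Fin n → ι) : ℝ :=
  ∏ k, Real.Gamma (a k + occurrences z k) / Real.Gamma (a k)

lemma prod_comp_eq_prod_pow_occurrences {ι : Type*} [Fintype ι] [DecidableEq ι] {n : ℕ}
    (z : Fin n → ι) (g : ι → ℝ) : ∏ i, g (z i) = ∏ k, g k ^ occurrences z k := by
  rw [← Finset.prod_fiberwise' Finset.univ z g]
  exact Finset.prod_congr rfl fun k _ => by rw [Finset.prod_const, occurrences]

lemma sum_occurrences {ι : Type*} [Fintype ι] [DecidableEq ι] {n : ℕ} (z : Fin n → ι) :
    ∑ k, occurrences z k = n := by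
  have := Finset.card_eq_sum_card_fiberwise (s := (Finset.univ : Finset (Fin n))) (f := z)
    (t := Finset.univ) (fun _ _ => Finset.mem_coe.2 (Finset.mem_univ _))
  rw [Finset.card_univ, Fintype.card_fin] at this
  exact this.symm

lemma urnWeight_nonneg {ι : Type*} [Fintype ι] [DecidableEq ι] {a : ι → ℝ} (ha : ∀ k, 0 < a k)
    {n : ℕ} (z : Fin n → ι) : 0 ≤ urnWeight a z := by
  refine Finset.prod_nonneg fun k _ => ?_
  have := ha k
  positivity

/-- The moment of order `m` of a Gamma variable tilted by `exp (- u x)`, which is a multiple of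
another Gamma density. -/
lemma lintegral_pow_mul_exp_gammaMeasure {a u : ℝ} (ha : 0 < a) (hu : 0 ≤ u) (m : ℕ) :
    ∫⁻ x, ENNReal.ofReal (x ^ m * Real.exp (-(u * x))) ∂ProbabilityTheory.gammaMeasure a 1
      = ENNReal.ofReal (Real.Gamma (a + m) / Real.Gamma a * (1 + u) ^ (-(a + m))) := by
  have hG := Real.Gamma_pos_of_pos ha
  have ham : 0 < a + m := by positivity
  have hGm := Real.Gamma_pos_of_pos ham
  have hu1 : 0 < 1 + u := by linarith
  rw [ProbabilityTheory.gammaMeasure, lintegral_withDensity_eq_lintegral_mul _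
    (by unfold ProbabilityTheory.gammaPDF; fun_prop) (by fun_prop)]
  have h : ∀ x : ℝ, (ProbabilityTheory.gammaPDF a 1
      * fun x => ENNReal.ofReal (x ^ m * Real.exp (-(u * x)))) x
      = ENNReal.ofReal (Real.Gamma (a + m) / Real.Gamma a * (1 + u) ^ (-(a + m)))
        * ProbabilityTheory.gammaPDF (a + m) (1 + u) x := by
    intro x
    rw [Pi.mul_apply, ProbabilityTheory.gammaPDF, ProbabilityTheory.gammaPDF,
      ← ENNReal.ofReal_mul (ProbabilityTheory.gammaPDFReal_nonneg ha one_pos x),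
      ← ENNReal.ofReal_mul (by positivity)]
    congr 1
    unfold ProbabilityTheory.gammaPDFReal
    split_ifs with hx
    · have e1 : x ^ (a - 1) * x ^ m = x ^ (a + m - 1) := by
        rcases Nat.eq_zero_or_pos m with rfl | hm
        · simp
        · rcases hx.eq_or_lt with rfl | hx
          · have : (1 : ℝ) ≤ m := by exact_mod_cast hm
            rw [zero_pow hm.ne', mul_zero,
              Real.zero_rpow (show a + (m : ℝ) - 1 ≠ 0 by intro h0; linarith)]
          · rw [← Real.rpow_natCast, ← Real.rpow_add hx]
            congr 1
            ring
      have e2 : Real.exp (-(1 * x)) * Real.exp (-(u * x)) = Real.exp (-((1 + u) * x)) := by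
        rw [← Real.exp_add]
        congr 1
        ring
      have e3 : (1 + u) ^ (-(a + m)) * (1 + u) ^ (a + m) = 1 := by
        rw [← Real.rpow_add hu1, neg_add_cancel, Real.rpow_zero]
      rw [Real.one_rpow, ← e1, ← e2]
      field_simp
      rw [mul_assoc, e3, mul_one]
    · simp
  simp_rw [h]
  rw [lintegral_const_mul _ (by unfold ProbabilityTheory.gammaPDF; fun_prop),
    ProbabilityTheory.lintegral_gammaPDF_eq_one ham hu1, mul_one]

/-- The law of a family of independent Gamma variables of rate one. -/
noncomputable def gammaPi {ι : Type*} [Fintype ι] (a : ι → ℝ) : Measure (ι → ℝ) :=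
  Measure.pi fun i => ProbabilityTheory.gammaMeasure (a i) 1

lemma isProbabilityMeasure_gammaPi {ι : Type*} [Fintype ι] {a : ι → ℝ} (ha : ∀ k, 0 < a k) :
    IsProbabilityMeasure (gammaPi a) := by
  have := fun i => ProbabilityTheory.isProbabilityMeasure_gammaMeasure (ha i) one_pos
  unfold gammaPi
  infer_instance

lemma gammaPi_ae_pos {ι : Type*} [Fintype ι] {a : ι → ℝ} (ha : ∀ k, 0 < a k) :
    ∀ᵐ g ∂gammaPi a, ∀ k, 0 < g k := by
  have := fun i => ProbabilityTheory.isProbabilityMeasure_gammaMeasure (ha i) one_pos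
  rw [Filter.eventually_all]
  intro k
  refine Measure.tendsto_eval_ae_ae.eventually (p := fun x : ℝ => 0 < x) ?_
  rw [ProbabilityTheory.gammaMeasure, ae_withDensity_iff
    (by unfold ProbabilityTheory.gammaPDF; fun_prop)]
  have h0 : ∀ᵐ x : ℝ, x ≠ 0 := by simp [ae_iff]
  filter_upwards [h0] with x hx hne
  by_contra hlt
  exact hne (ProbabilityTheory.gammaPDF_of_neg (lt_of_le_of_ne (not_lt.1 hlt) hx))

/-- Independence of the coordinates, in the form used: a product of tilted moments. -/
lemma lintegral_prod_pow_mul_exp_gammaPi {ι : Type*} [Fintype ι] [DecidableEq ι] {a : ι → ℝ}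
    (ha : ∀ k, 0 < a k) {u : ℝ} (hu : 0 ≤ u) {n : ℕ} (z : Fin n → ι) :
    ∫⁻ g, ∏ k, ENNReal.ofReal (g k ^ occurrences z k * Real.exp (-(u * g k))) ∂gammaPi a
      = ENNReal.ofReal (urnWeight a z) * ENNReal.ofReal ((1 + u) ^ (-((∑ k, a k) + n))) := by
  have := fun i => ProbabilityTheory.isProbabilityMeasure_gammaMeasure (ha i) one_pos
  have hu1 : 0 < 1 + u := by linarith
  have hind := ProbabilityTheory.iIndepFun_pi
    (μ := fun i => ProbabilityTheory.gammaMeasure (a i) 1)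
    (X := fun k x => ENNReal.ofReal (x ^ occurrences z k * Real.exp (-(u * x))))
    (fun k => by fun_prop)
  have h1 := ProbabilityTheory.lintegral_prod_eq_prod_lintegral_of_indepFun Finset.univ _ hind
    (fun k => by fun_prop)
  unfold gammaPi
  rw [h1]
  have h2 : ∀ k, ∫⁻ g : ι → ℝ, ENNReal.ofReal (g k ^ occurrences z k * Real.exp (-(u * g k)))
      ∂(Measure.pi fun i => ProbabilityTheory.gammaMeasure (a i) 1)
      = ENNReal.ofReal (Real.Gamma (a k + occurrences z k) / Real.Gamma (a k)
        * (1 + u) ^ (-(a k + occurrences z k))) := by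
    intro k
    rw [← lintegral_pow_mul_exp_gammaMeasure (ha k) hu,
      ← (measurePreserving_eval (fun i => ProbabilityTheory.gammaMeasure (a i) 1) k).lintegral_comp
        (by fun_prop)]
  simp_rw [h2]
  rw [← ENNReal.ofReal_prod_of_nonneg (fun k _ => by have := ha k; positivity),
    ← ENNReal.ofReal_mul (urnWeight_nonneg ha z), Finset.prod_mul_distrib, urnWeight]
  congr 2
  rw [← Real.rpow_sum_of_pos hu1, Finset.sum_neg_distrib, Finset.sum_add_distrib]
  congr 3
  exact_mod_cast sum_occurrences z

/-- The factor relating the moments of order `n` of a Dirichlet distribution of total mass `s` to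
those of the Gamma variables, for `n ≥ 1`. Its value `Γ(s) / Γ(s + n)` is not needed, only that it
depends on `s` and `n` alone. -/
noncomputable def dirichletFactor (s : ℝ) (n : ℕ) : ENNReal :=
  ∫⁻ u, ENNReal.ofReal (if 0 ≤ u then u ^ ((n : ℝ) - 1) / Real.Gamma n else 0)
    * ENNReal.ofReal ((1 + u) ^ (-(s + n)))

/-- The moments of the normalized Gamma vector, obtained by writing `1 / S ^ n` as the integral of
`u ^ (n - 1) * exp (- u S) / Γ(n)` over `u > 0`. -/
lemma lintegral_prod_div_sum_gammaPi {ι : Type*} [Fintype ι] [DecidableEq ι] {a : ι → ℝ}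
    (ha : ∀ k, 0 < a k) {n : ℕ} (hn : 1 ≤ n) (z : Fin n → ι) :
    ∫⁻ g, ENNReal.ofReal (∏ i, g (z i) / ∑ j, g j) ∂gammaPi a
      = ENNReal.ofReal (urnWeight a z) * dirichletFactor (∑ k, a k) n := by
  have hprob := isProbabilityMeasure_gammaPi ha
  have hn0 : (0 : ℝ) < n := by exact_mod_cast hn
  have hΓ := Real.Gamma_pos_of_pos hn0
  set h : ℝ → ℝ := fun u => if 0 ≤ u then u ^ ((n : ℝ) - 1) / Real.Gamma n else 0 with hh
  have hhm : Measurable h := Measurable.ite measurableSet_Ici (by fun_prop) measurable_const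
  have hh0 : ∀ u, 0 ≤ h u := by
    intro u
    simp only [hh]
    split_ifs with hu
    · positivity
    · exact le_rfl
  have key : ∀ᵐ g ∂gammaPi a, ENNReal.ofReal (∏ i, g (z i) / ∑ j, g j)
      = ∫⁻ u, ENNReal.ofReal (h u)
        * ∏ k, ENNReal.ofReal (g k ^ occurrences z k * Real.exp (-(u * g k))) := by
    filter_upwards [gammaPi_ae_pos ha] with g hg
    have hS : 0 < ∑ j, g j :=
      Finset.sum_pos (fun j _ => hg j) ⟨z ⟨0, hn⟩, Finset.mem_univ _⟩
    have hP : 0 < ∏ i, g (z i) := Finset.prod_pos fun i _ => hg _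
    have e0 : ∏ i, g (z i) / ∑ j, g j = (∏ i, g (z i)) / (∑ j, g j) ^ n := by
      rw [Finset.prod_div_distrib, Finset.prod_const, Finset.card_univ, Fintype.card_fin]
    have e1 : ∀ u, ENNReal.ofReal (h u)
        * ∏ k, ENNReal.ofReal (g k ^ occurrences z k * Real.exp (-(u * g k)))
        = ENNReal.ofReal (∏ i, g (z i) / ∑ j, g j)
          * ProbabilityTheory.gammaPDF n (∑ j, g j) u := by
      intro u
      rw [← ENNReal.ofReal_prod_of_nonneg (fun k _ => by have := hg k; positivity),
        ← ENNReal.ofReal_mul (hh0 u), ProbabilityTheory.gammaPDF,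
        ← ENNReal.ofReal_mul (by rw [e0]; positivity), Finset.prod_mul_distrib,
        ← prod_comp_eq_prod_pow_occurrences, ← Real.exp_sum, Finset.sum_neg_distrib,
        ← Finset.mul_sum, e0]
      congr 1
      simp only [hh, ProbabilityTheory.gammaPDFReal]
      split_ifs with hu
      · rw [Real.rpow_natCast, mul_comm u]
        field_simp
      · simp
    simp_rw [e1]
    rw [lintegral_const_mul _ (by unfold ProbabilityTheory.gammaPDF; fun_prop),
      ProbabilityTheory.lintegral_gammaPDF_eq_one hn0 hS, mul_one]
  rw [lintegral_congr_ae key, lintegral_lintegral_swap (by unfold Function.uncurry; fun_prop)]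
  rw [dirichletFactor, ← lintegral_const_mul _ (by
    refine (Measurable.ennreal_ofReal hhm).mul ?_
    fun_prop)]
  refine lintegral_congr fun u => ?_
  rw [lintegral_const_mul _ (by fun_prop)]
  by_cases hu : 0 ≤ u
  · rw [lintegral_prod_pow_mul_exp_gammaPi ha hu]
    simp only [hh]
    ring
  · simp [hh, hu]

lemma measurable_div_sum {ι : Type*} [Fintype ι] :
    Measurable fun (g : ι → ℝ) i => g i / ∑ j, g j := by fun_prop

lemma integrable_prod_div_sum_gammaPi {ι : Type*} [Fintype ι] {a : ι → ℝ} (ha : ∀ k, 0 < a k)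
    {n : ℕ} (z : Fin n → ι) : Integrable (fun g => ∏ i, g (z i) / ∑ j, g j) (gammaPi a) := by
  have hprob := isProbabilityMeasure_gammaPi ha
  refine Integrable.of_bound (C := 1)
    (Measurable.aestronglyMeasurable (by fun_prop)) ?_
  filter_upwards [gammaPi_ae_pos ha] with g hg
  rw [norm_prod]
  refine Finset.prod_le_one (fun i _ => norm_nonneg _) fun i _ => ?_
  have hS : 0 < ∑ j, g j := Finset.sum_pos (fun j _ => hg j) ⟨z i, Finset.mem_univ _⟩
  rw [Real.norm_of_nonneg (div_nonneg (hg _).le hS.le), div_le_one hS]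
  exact Finset.single_le_sum (fun j _ => (hg j).le) (Finset.mem_univ _)

lemma dirichletMeasure_eq_map {ι : Type*} [Fintype ι] (a : ι → ℝ) :
    dirichletMeasure a = (gammaPi a).map fun g i => g i / ∑ j, g j := rfl

lemma integrable_prod_dirichletMeasure {ι : Type*} [Fintype ι] {a : ι → ℝ} (ha : ∀ k, 0 < a k)
    {n : ℕ} (z : Fin n → ι) : Integrable (fun q => ∏ i, q (z i)) (dirichletMeasure a) := by
  rw [dirichletMeasure_eq_map, integrable_map_measure
    (Measurable.aestronglyMeasurable (by fun_prop))
    measurable_div_sum.aemeasurable]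
  exact integrable_prod_div_sum_gammaPi ha z

lemma integral_prod_dirichletMeasure {ι : Type*} [Fintype ι] [DecidableEq ι] {a : ι → ℝ}
    (ha : ∀ k, 0 < a k) {n : ℕ} (hn : 1 ≤ n) (z : Fin n → ι) :
    ∫ q, ∏ i, q (z i) ∂dirichletMeasure a
      = (dirichletFactor (∑ k, a k) n).toReal * urnWeight a z := by
  rw [dirichletMeasure_eq_map, integral_map measurable_div_sum.aemeasurable
    (Measurable.aestronglyMeasurable (by fun_prop)),
    integral_eq_lintegral_of_nonneg_ae _
      (integrable_prod_div_sum_gammaPi ha z).aestronglyMeasurable,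
    lintegral_prod_div_sum_gammaPi ha hn, ENNReal.toReal_mul,
    ENNReal.toReal_ofReal (urnWeight_nonneg ha z), mul_comm]
  filter_upwards [gammaPi_ae_pos ha] with g hg
  exact Finset.prod_nonneg fun i _ => div_nonneg (hg _).le (Finset.sum_nonneg fun j _ => (hg j).le)

/-- The moments of order `n` of a Dirichlet vector sum to one, so that the factor cannot vanish. -/
lemma dirichletFactor_toReal_ne_zero {ι : Type*} [Fintype ι] [Nonempty ι] {a : ι → ℝ}
    (ha : ∀ k, 0 < a k) {n : ℕ} (hn : 1 ≤ n) : (dirichletFactor (∑ k, a k) n).toReal ≠ 0 := by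
  classical
  intro h0
  have hprob := isProbabilityMeasure_gammaPi ha
  have h1 : ∫ q, ∑ z : Fin n → ι, ∏ i, q (z i) ∂dirichletMeasure a = 0 := by
    rw [integral_finsetSum _ fun z _ => integrable_prod_dirichletMeasure ha z]
    exact Finset.sum_eq_zero fun z _ => by
      rw [integral_prod_dirichletMeasure ha hn, h0, zero_mul]
  have h2 : ∫ q, ∑ z : Fin n → ι, ∏ i, q (z i) ∂dirichletMeasure a = 1 := by
    rw [dirichletMeasure_eq_map, integral_map measurable_div_sum.aemeasurable
    (Measurable.aestronglyMeasurable (by fun_prop))]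
    have h3 : ∀ᵐ g ∂gammaPi a, ∑ z : Fin n → ι, ∏ i, g (z i) / ∑ j, g j = 1 := by
      filter_upwards [gammaPi_ae_pos ha] with g hg
      have hS : 0 < ∑ j, g j := Finset.sum_pos (fun j _ => hg j) Finset.univ_nonempty
      have h4 := Finset.prod_univ_sum (fun _ : Fin n => (Finset.univ : Finset ι))
        (fun _ k => g k / ∑ j, g j)
      rw [Fintype.piFinset_univ] at h4
      rw [← h4, ← Finset.sum_div, div_self hS.ne', Finset.prod_const_one]
    rw [integral_congr_ae h3]
    simp
  rw [h1] at h2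
  exact zero_ne_one h2

/-! ### The urn recursion -/

/-- The expectation of a product of linear forms `∑ k, g k * F i k` of independent Gamma variables
`g k` of shapes `a k`, written as a finite sum. -/
noncomputable def urnSum {ι : Type*} [Fintype ι] [DecidableEq ι] (a : ι → ℝ) {n : ℕ}
    (F : Fin n → ι → ℝ) : ℝ :=
  ∑ z : Fin n → ι, urnWeight a z * ∏ i, F i (z i)

lemma ldaProb_eq_urnSum {V : ℕ} {ι : Type*} [Fintype ι] [DecidableEq ι] {a : ι → ℝ}
    (ha : ∀ k, 0 < a k) (Θ : ι → Topic V) {n : ℕ} (hn : 1 ≤ n) (x : Fin n → Fin V) :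
    ldaProb a Θ n x = (dirichletFactor (∑ k, a k) n).toReal
      * urnSum a fun i k => (Θ k).1 (x i) := by
  unfold ldaProb urnSum
  have h : ∀ q : ι → ℝ, ∏ i, ∑ k, q k * (Θ k).1 (x i)
      = ∑ z : Fin n → ι, (∏ i, q (z i)) * ∏ i, (Θ (z i)).1 (x i) := by
    intro q
    rw [Finset.prod_univ_sum, Fintype.piFinset_univ]
    simp_rw [Finset.prod_mul_distrib]
  simp_rw [h]
  rw [integral_finsetSum _ fun z _ => (integrable_prod_dirichletMeasure ha z).mul_const _,
    Finset.mul_sum]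
  refine Finset.sum_congr rfl fun z _ => ?_
  rw [integral_mul_const, integral_prod_dirichletMeasure ha hn, mul_assoc]

lemma occurrences_cons {ι : Type*} [DecidableEq ι] {n : ℕ} (k : ι) (z : Fin n → ι) (j : ι) :
    occurrences (Fin.cons k z : Fin (n + 1) → ι) j
      = (if k = j then 1 else 0) + occurrences z j := by
  simp only [occurrences, Finset.card_filter, Fin.sum_univ_succ, Fin.cons_zero, Fin.cons_succ]

lemma urnWeight_cons {ι : Type*} [Fintype ι] [DecidableEq ι] {a : ι → ℝ} (ha : ∀ k, 0 < a k)
    {n : ℕ} (k : ι) (z : Fin n → ι) :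
    urnWeight a (Fin.cons k z : Fin (n + 1) → ι) = (a k + occurrences z k) * urnWeight a z := by
  unfold urnWeight
  rw [← Finset.mul_prod_erase _ _ (Finset.mem_univ k),
    ← Finset.mul_prod_erase Finset.univ (fun j => Real.Gamma (a j + occurrences z j) / _)
      (Finset.mem_univ k), ← mul_assoc]
  congr 1
  · rw [occurrences_cons, if_pos rfl]
    have hk : a k + occurrences z k ≠ 0 := by
      have := ha k
      positivity
    rw [Nat.cast_add, Nat.cast_one, add_left_comm, add_comm, Real.Gamma_add_one hk, mul_div_assoc]
  · refine Finset.prod_congr rfl fun j hj => ?_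
    rw [occurrences_cons, if_neg (Finset.ne_of_mem_erase hj).symm, zero_add]

lemma sum_occurrences_mul {ι : Type*} [Fintype ι] [DecidableEq ι] {n : ℕ} (z : Fin n → ι)
    (g : ι → ℝ) : ∑ k, (occurrences z k : ℝ) * g k = ∑ i, g (z i) := by
  rw [← Finset.sum_fiberwise' Finset.univ z g]
  exact Finset.sum_congr rfl fun k _ => by rw [Finset.sum_const, nsmul_eq_mul, occurrences]

/-- The recursion of Pólya's urn: the first factor is either drawn afresh or merged into one of the
others. -/
lemma urnSum_cons {ι : Type*} [Fintype ι] [DecidableEq ι] {a : ι → ℝ} (ha : ∀ k, 0 < a k) {n : ℕ}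
    (g : ι → ℝ) (F : Fin n → ι → ℝ) :
    urnSum a (Fin.cons g F : Fin (n + 1) → ι → ℝ) = (∑ k, a k * g k) * urnSum a F
      + ∑ i, urnSum a (Function.update F i (g * F i)) := by
  have hupd : ∀ (i : Fin n) (z : Fin n → ι),
      ∏ j, Function.update F i (g * F i) j (z j) = g (z i) * ∏ j, F j (z j) := by
    intro i z
    rw [← Finset.mul_prod_erase _ _ (Finset.mem_univ i),
      ← Finset.mul_prod_erase _ (fun j => F j (z j)) (Finset.mem_univ i),
      Function.update_self, Pi.mul_apply, mul_assoc]
    congr 2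
    exact Finset.prod_congr rfl fun j hj => by
      rw [Function.update_of_ne (Finset.ne_of_mem_erase hj)]
  unfold urnSum
  rw [← (Fin.consEquiv fun _ => ι).sum_comp, Fintype.sum_prod_type, Finset.sum_comm]
  have h1 : ∀ z : Fin n → ι, ∑ k, urnWeight a (Fin.cons k z : Fin (n + 1) → ι)
      * ∏ i, (Fin.cons g F : Fin (n + 1) → ι → ℝ) i ((Fin.cons k z : Fin (n + 1) → ι) i)
      = (∑ k, a k * g k) * (urnWeight a z * ∏ i, F i (z i))
        + ∑ i, urnWeight a z * (g (z i) * ∏ j, F j (z j)) := by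
    intro z
    simp_rw [urnWeight_cons ha, Fin.prod_univ_succ, Fin.cons_zero, Fin.cons_succ]
    have e1 : ∀ k, (a k + occurrences z k) * urnWeight a z * (g k * ∏ i, F i (z i))
        = a k * g k * (urnWeight a z * ∏ i, F i (z i))
          + (occurrences z k * g k) * (urnWeight a z * ∏ i, F i (z i)) := fun k => by ring
    simp_rw [e1]
    rw [Finset.sum_add_distrib, ← Finset.sum_mul, ← Finset.sum_mul, sum_occurrences_mul]
    congr 1
    rw [Finset.sum_mul]
    exact Finset.sum_congr rfl fun i _ => by ring
  refine (Finset.sum_congr rfl fun z _ => h1 z).trans ?_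
  rw [Finset.sum_add_distrib, ← Finset.mul_sum, Finset.sum_comm (s := Finset.univ (α := Fin n → ι))]
  simp_rw [hupd]

lemma urnWeight_comp_perm {ι : Type*} [Fintype ι] [DecidableEq ι] (a : ι → ℝ) {n : ℕ}
    (z : Fin n → ι) (σ : Equiv.Perm (Fin n)) : urnWeight a (z ∘ σ) = urnWeight a z := by
  unfold urnWeight
  have h : ∀ k, occurrences (z ∘ σ) k = occurrences z k := by
    intro k
    simp only [occurrences, Finset.card_filter, Function.comp_apply]
    exact Equiv.sum_comp σ fun i => if z i = k then 1 else 0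
  simp_rw [h]

lemma urnSum_comp_perm {ι : Type*} [Fintype ι] [DecidableEq ι] (a : ι → ℝ) {n : ℕ}
    (F : Fin n → ι → ℝ) (σ : Equiv.Perm (Fin n)) : urnSum a (F ∘ σ) = urnSum a F := by
  unfold urnSum
  refine Fintype.sum_equiv (σ.arrowCongr (Equiv.refl ι)) _ _ fun z => ?_
  have h : (σ.arrowCongr (Equiv.refl ι)) z = z ∘ σ.symm := rfl
  rw [h, urnWeight_comp_perm]
  congr 1
  rw [← Equiv.prod_comp σ fun i => F i ((z ∘ σ.symm) i)]
  simp

/-- The urn recursion for equal factors, in which merging gives the same value at each place. -/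
lemma urnSum_cons_const {ι : Type*} [Fintype ι] [DecidableEq ι] {a : ι → ℝ} (ha : ∀ k, 0 < a k)
    (m : ℕ) (g f : ι → ℝ) :
    urnSum a (Fin.cons g (fun _ => f) : Fin (m + 2) → ι → ℝ)
      = (∑ k, a k * g k) * urnSum a (fun _ : Fin (m + 1) => f)
        + (m + 1) * urnSum a (Fin.cons (g * f) (fun _ => f) : Fin (m + 1) → ι → ℝ) := by
  rw [urnSum_cons ha]
  congr 1
  have h : ∀ i : Fin (m + 1), urnSum a (Function.update (fun _ => f) i (g * f))
      = urnSum a (Fin.cons (g * f) (fun _ => f) : Fin (m + 1) → ι → ℝ) := by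
    intro i
    rw [← urnSum_comp_perm a _ (Equiv.swap 0 i)]
    congr 1
    funext j
    rw [Function.comp_apply]
    refine Fin.cases ?_ (fun j => ?_) j
    · simp
    · rw [Fin.cons_succ]
      by_cases hj : j.succ = i
      · subst hj
        rw [Equiv.swap_apply_right, Function.update_of_ne (Fin.succ_ne_zero j).symm]
      · rw [Equiv.swap_apply_of_ne_of_ne (Fin.succ_ne_zero j) hj, Function.update_of_ne hj]
  rw [Finset.sum_congr rfl fun i _ => h i]
  simp

lemma urnSum_single {ι : Type*} [Fintype ι] [DecidableEq ι] {a : ι → ℝ} (ha : ∀ k, 0 < a k)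
    (g : ι → ℝ) (F : Fin 0 → ι → ℝ) :
    urnSum a (Fin.cons g F : Fin 1 → ι → ℝ) = ∑ k, a k * g k := by
  rw [urnSum_cons ha]
  have : urnSum a F = 1 := by
    have hΓ := fun k => (Real.Gamma_pos_of_pos (ha k)).ne'
    simp [urnSum, urnWeight, occurrences, hΓ]
  simp [this]

lemma urnSum_cons_one {ι : Type*} [Fintype ι] [DecidableEq ι] {a : ι → ℝ} (ha : ∀ k, 0 < a k)
    {n : ℕ} (F : Fin n → ι → ℝ) :
    urnSum a (Fin.cons 1 F : Fin (n + 1) → ι → ℝ) = ((∑ k, a k) + n) * urnSum a F := by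
  rw [urnSum_cons ha]
  simp [add_mul]

/-! ### From document distributions to moments -/

lemma exists_eq_sum_of_mem_coordSpan {V : ℕ} {f : Topic V → ℝ} (hf : f ∈ coordSpan V) :
    ∃ u : Fin V → ℝ, ∀ θ : Topic V, f θ = ∑ v, u v * θ.1 v := by
  obtain ⟨u, hu⟩ := (Submodule.mem_span_range_iff_exists_fun ℝ).1 hf
  exact ⟨u, fun θ => by rw [← hu]; simp⟩

/-- Polarization: a linear functional vanishing on the `N`-th powers of linear forms vanishes on
all products of `N` linear forms. -/
lemma map_eq_zero_of_map_pow_eq_zero {R : Type*} [CommRing R] [Algebra ℝ R] (L : Submodule ℝ R)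
    (Λ : R →ₗ[ℝ] ℝ) (N : ℕ) (h : ∀ f ∈ L, Λ (f ^ N) = 0) : ∀ f ∈ L ^ N, Λ f = 0 := by
  have key : ∀ r n, n + r = N → ∀ f ∈ L, ∀ g ∈ L ^ r, Λ (f ^ n * g) = 0 := by
    intro r
    induction r with
    | zero =>
      intro n hn f hf g hg
      rw [pow_zero, Submodule.mem_one] at hg
      obtain ⟨c, rfl⟩ := hg
      rw [mul_comm, ← Algebra.smul_def, map_smul, show n = N by omega, h f hf, smul_zero]
    | succ r ih =>
      intro n hn f hf g hg
      rw [pow_succ] at hg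
      induction hg using Submodule.mul_induction_on' with
      | mem_mul_mem g hg l hl =>
        -- the coefficient of `X` in `Λ ((f + X l) ^ (n + 1) * g)`
        set p : Polynomial ℝ := ∑ j ∈ Finset.range (n + 1 + 1),
          Polynomial.C (Λ (l ^ j * f ^ (n + 1 - j) * ((n + 1).choose j : R) * g))
            * Polynomial.X ^ j with hp
        have hp0 : p = 0 := by
          refine Polynomial.funext fun t => ?_
          have h1 := ih (n + 1) (by omega) (t • l + f) (L.add_mem (L.smul_mem t hl) hf) g hg
          rw [add_pow, Finset.sum_mul, map_sum] at h1
          rw [hp, Polynomial.eval_finsetSum, Polynomial.eval_zero, ← h1]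
          refine Finset.sum_congr rfl fun j _ => ?_
          rw [Polynomial.eval_mul, Polynomial.eval_C, Polynomial.eval_pow, Polynomial.eval_X,
            smul_pow, smul_mul_assoc, smul_mul_assoc, smul_mul_assoc, map_smul, smul_eq_mul,
            mul_comm]
        have h2 := congrArg (fun q => Polynomial.coeff q 1) hp0
        simp only [hp, Polynomial.finsetSum_coeff, Polynomial.coeff_C_mul_X_pow,
          Polynomial.coeff_zero] at h2
        rw [Finset.sum_eq_single 1 (fun j _ hj => if_neg hj.symm) (by simp), if_pos rfl] at h2
        have h3 : l ^ 1 * f ^ (n + 1 - 1) * ((n + 1).choose 1 : R) * g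
            = ((n + 1 : ℕ) : ℝ) • (f ^ n * (g * l)) := by
          rw [Algebra.smul_def, map_natCast, Nat.choose_one_right, Nat.add_sub_cancel]
          ring
        rw [h3, map_smul, smul_eq_mul] at h2
        exact (mul_eq_zero.1 h2).resolve_left (by positivity)
      | add x _ y _ hx hy => rw [mul_add, map_add, hx, hy, add_zero]
  intro f hf
  rcases Nat.eq_zero_or_pos N with rfl | hN
  · simpa using key 0 0 rfl 0 L.zero_mem f hf
  · simpa using key N 0 (by omega) 0 L.zero_mem f hf

lemma MixingMeasure.integral_eq_sum_coe {V : ℕ} (G : MixingMeasure V) (f : Topic V → ℝ) :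
    G.integral f = ∑ θ : G.atoms, G.weight θ * f θ := by
  rw [G.integral_apply, ← Finset.sum_coe_sort]

lemma MixingMeasure.sum_weight {V : ℕ} (G : MixingMeasure V) : ∑ θ : G.atoms, G.weight θ = 1 := by
  rw [Finset.sum_coe_sort G.atoms fun θ => G.weight θ]
  exact G.sum_eq_one

lemma MixingMeasure.atoms_nonempty {V : ℕ} (G : MixingMeasure V) : G.atoms.Nonempty := by
  by_contra h
  have h1 := G.sum_eq_one
  rw [Finset.not_nonempty_iff_eq_empty, MixingMeasure.atoms] at h
  rw [h, Finset.sum_empty] at h1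
  exact zero_ne_one h1

/-- Multilinear expansion: a finite sum of values of products of linear forms is determined by the
corresponding sums for the documents. -/
lemma exists_sum_mul_prod_eq_sum_document {V N : ℕ} (F : Fin N → Topic V → ℝ)
    (hF : ∀ i, F i ∈ coordSpan V) : ∃ w : (Fin N → Fin V) → ℝ,
    ∀ {ι : Type} [Fintype ι] (c : ι → ℝ) (X : ι → Fin N → Topic V),
      ∑ z, c z * ∏ i, F i (X z i) = ∑ x, w x * ∑ z, c z * ∏ i, (X z i).1 (x i) := by
  choose u hu using fun i => exists_eq_sum_of_mem_coordSpan (hF i)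
  refine ⟨fun x => ∏ i, u i (x i), fun c X => ?_⟩
  simp_rw [Finset.mul_sum]
  rw [Finset.sum_comm]
  refine Finset.sum_congr rfl fun z _ => ?_
  simp_rw [hu]
  rw [Finset.prod_univ_sum, Fintype.piFinset_univ, Finset.mul_sum]
  refine Finset.sum_congr rfl fun x _ => ?_
  rw [Finset.prod_mul_distrib]
  ring

lemma sum_mul_prod_eq_of_forall_document {V N : ℕ} {ι κ : Type} [Fintype ι] [Fintype κ]
    (c : ι → ℝ) (X : ι → Fin N → Topic V) (d : κ → ℝ) (Y : κ → Fin N → Topic V)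
    (h : ∀ x : Fin N → Fin V, ∑ z, c z * ∏ i, (X z i).1 (x i) = ∑ z, d z * ∏ i, (Y z i).1 (x i))
    (F : Fin N → Topic V → ℝ) (hF : ∀ i, F i ∈ coordSpan V) :
    ∑ z, c z * ∏ i, F i (X z i) = ∑ z, d z * ∏ i, F i (Y z i) := by
  obtain ⟨w, hw⟩ := exists_sum_mul_prod_eq_sum_document F hF
  rw [hw, hw]
  exact Finset.sum_congr rfl fun x _ => by rw [h x]

/-- For the mixture model, the documents of length `N` record the integrals of the monomials. -/
lemma momentsAgree_of_mixtureModel {V N : ℕ} {G G₀ : MixingMeasure V}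
    (h : mixtureModel V G₀ N = mixtureModel V G N) : MomentsAgree G G₀ N := by
  have h1 := map_eq_zero_of_map_pow_eq_zero (coordSpan V)
      (G.integral - G₀.integral) N fun f hf => by
    have h2 := sum_mul_prod_eq_of_forall_document (fun θ : G.atoms => G.weight θ)
      (fun θ _ => (θ : Topic V)) (fun θ : G₀.atoms => G₀.weight θ) (fun θ _ => (θ : Topic V))
      (fun x => (congrFun h x).symm) (fun _ : Fin N => f) fun _ => hf
    simp only [Finset.prod_const, Finset.card_univ, Fintype.card_fin] at h2
    rw [LinearMap.sub_apply, sub_eq_zero, G.integral_eq_sum_coe, G₀.integral_eq_sum_coe]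
    exact h2
  intro f hf
  have := h1 f hf
  rwa [LinearMap.sub_apply, sub_eq_zero] at this

/-- For the LDA model, the documents of length `N` record the values of all urn sums of products
of `N` linear forms; constants being linear forms, also those of fewer factors. The urn recursion
then yields inductively the urn sums of `f ^ j` and `m` further factors `f`, and with them the
integrals of the powers `f ^ j`, for `j + m ≤ N`. -/
lemma momentsAgree_of_ldaModel {V N : ℕ} (hN : 1 ≤ N) {abar : ℝ} (habar : 0 < abar)
    {G G₀ : MixingMeasure V} (h : ldaModel V abar G₀ N = ldaModel V abar G N) :
    MomentsAgree G G₀ N := by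
  classical
  let T : MixingMeasure V → ∀ {n : ℕ}, (Fin n → Topic V → ℝ) → ℝ := fun G n F =>
    urnSum (fun θ : G.atoms => abar * G.weight θ) fun i θ => F i θ
  have hpos : ∀ G : MixingMeasure V, ∀ θ : G.atoms, 0 < abar * G.weight θ :=
    fun G θ => mul_pos habar (MixingMeasure.weight_pos θ.2)
  have hsum : ∀ G : MixingMeasure V, ∑ θ : G.atoms, abar * G.weight θ = abar := fun G => by
    rw [← Finset.mul_sum, G.sum_weight, mul_one]
  have hsum' : ∀ (G : MixingMeasure V) (f : Topic V → ℝ),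
      ∑ θ : G.atoms, abar * G.weight θ * f θ = abar * G.integral f := fun G f => by
    rw [G.integral_eq_sum_coe, Finset.mul_sum]
    exact Finset.sum_congr rfl fun _ _ => by ring
  have hcons : ∀ (G : MixingMeasure V) {n : ℕ} (g : Topic V → ℝ) (F : Fin n → Topic V → ℝ),
      T G (Fin.cons g F : Fin (n + 1) → Topic V → ℝ)
        = urnSum (fun θ : G.atoms => abar * G.weight θ)
          (Fin.cons (fun θ : G.atoms => g θ) (fun i (θ : G.atoms) => F i θ)
            : Fin (n + 1) → G.atoms → ℝ) := by
    intro G n g F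
    refine congrArg (urnSum _) (funext fun i => ?_)
    refine Fin.cases ?_ (fun i => ?_) i
    · rfl
    · rfl
  have hdoc : ∀ F : Fin N → Topic V → ℝ, (∀ i, F i ∈ coordSpan V) → T G F = T G₀ F := by
    refine sum_mul_prod_eq_of_forall_document _
      (fun (z : Fin N → G.atoms) i => (z i : Topic V)) _
      (fun (z : Fin N → G₀.atoms) i => (z i : Topic V)) fun x => ?_
    have h1 := congrFun h x
    have : Nonempty G.atoms := G.atoms_nonempty.coe_sort
    have hne := dirichletFactor_toReal_ne_zero (hpos G) hN
    unfold ldaModel at h1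
    rw [ldaProb_eq_urnSum (hpos G₀) _ hN, ldaProb_eq_urnSum (hpos G) _ hN, hsum, hsum] at h1
    rw [hsum] at hne
    exact (mul_left_cancel₀ hne h1).symm
  have hlow : ∀ d n, n + d = N → ∀ F : Fin n → Topic V → ℝ, (∀ i, F i ∈ coordSpan V) →
      T G F = T G₀ F := by
    intro d
    induction d with
    | zero =>
      rintro n rfl F hF
      exact hdoc F hF
    | succ d ih =>
      intro n hn F hF
      have h1 := ih (n + 1) (by omega) (Fin.cons 1 F) fun i => by
        refine Fin.cases ?_ (fun i => ?_) i
        · exact one_mem_coordSpan V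
        · exact hF i
      have h2 : ∀ G : MixingMeasure V, T G (Fin.cons 1 F : Fin (n + 1) → Topic V → ℝ)
          = (abar + n) * T G F := by
        intro G
        rw [hcons]
        have h3 := urnSum_cons_one (hpos G) fun i (θ : G.atoms) => F i θ
        rw [hsum] at h3
        exact h3
      rw [h2, h2] at h1
      exact mul_left_cancel₀ (by positivity) h1
  have hpow : ∀ f ∈ coordSpan V, ∀ j m, j + 1 + m ≤ N →
      T G (Fin.cons (f ^ (j + 1)) (fun _ => f) : Fin (m + 1) → Topic V → ℝ)
        = T G₀ (Fin.cons (f ^ (j + 1)) (fun _ => f) : Fin (m + 1) → Topic V → ℝ) := by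
    intro f hf j
    induction j with
    | zero =>
      intro m hm
      refine hlow (N - (m + 1)) _ (by omega) _ fun i => ?_
      refine Fin.cases ?_ (fun i => ?_) i
      · rw [zero_add, pow_one]
        exact hf
      · exact hf
    | succ j ih =>
      intro m hm
      have h1 := ih (m + 1) (by omega)
      have h2 := ih 0 (by omega)
      have h3 := hlow (N - (m + 1)) (m + 1) (by omega) (fun _ => f) fun _ => hf
      have hsingle : ∀ G : MixingMeasure V,
          T G (Fin.cons (f ^ (j + 1)) (fun _ => f) : Fin 1 → Topic V → ℝ)
            = abar * G.integral (f ^ (j + 1)) := fun G => by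
        rw [hcons, urnSum_single (hpos G), ← hsum']
      have hrec : ∀ G : MixingMeasure V,
          T G (Fin.cons (f ^ (j + 1)) (fun _ => f) : Fin (m + 2) → Topic V → ℝ)
            = abar * G.integral (f ^ (j + 1)) * T G (fun _ : Fin (m + 1) => f)
              + (m + 1) * T G (Fin.cons (f ^ (j + 1 + 1)) (fun _ => f)
                : Fin (m + 1) → Topic V → ℝ) := fun G => by
        rw [hcons, urnSum_cons_const (hpos G), hcons, ← hsum', pow_succ f (j + 1)]
        rfl
      rw [hsingle, hsingle] at h2
      rw [hrec, hrec, h2, h3] at h1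
      have h4 := add_left_cancel h1
      exact mul_left_cancel₀ (by positivity) h4
  have h1 := map_eq_zero_of_map_pow_eq_zero (coordSpan V)
      (G.integral - G₀.integral) N fun f hf => by
    obtain ⟨n, rfl⟩ : ∃ n, N = n + 1 := ⟨N - 1, by omega⟩
    have h2 := hpow f hf n 0 le_rfl
    rw [hcons, hcons, urnSum_single (hpos G), urnSum_single (hpos G₀), hsum', hsum'] at h2
    rw [LinearMap.sub_apply, sub_eq_zero]
    exact mul_left_cancel₀ habar.ne' h2
  intro f hf
  have := h1 f hf
  rwa [LinearMap.sub_apply, sub_eq_zero] at this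

/-! ### Minimal document lengths -/

lemma mem_atMostAtoms {V K : ℕ} {G : MixingMeasure V} (h : G ∈ atMostAtoms V K) :
    G.atoms.card ≤ K := by
  simp only [atMostAtoms, Set.mem_iUnion, Finset.mem_Icc, exactAtoms, Set.mem_ofPred_eq] at h
  obtain ⟨k, hk, hG⟩ := h
  omega

lemma minOverfittedLength_le {V : ℕ} {p : DocumentModel V} {G₀ : MixingMeasure V} {K N : ℕ}
    (hN : 1 ≤ N) (h : IdentifiableUpTo p G₀ K N) : minOverfittedLength p G₀ K ≤ (N : ℕ∞) :=
  sInf_le ⟨N, hN, h, rfl⟩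

lemma minExactLength_le {V : ℕ} {p : DocumentModel V} {G₀ : MixingMeasure V} {N : ℕ}
    (hN : 1 ≤ N) (h : IdentifiableUpTo p G₀ G₀.atoms.card N) : minExactLength p G₀ ≤ (N : ℕ∞) :=
  sInf_le ⟨N, hN, h, rfl⟩

theorem proposition3 (V : ℕ) (abar : ℝ) (habar : 0 < abar)
    (p : DocumentModel V) (hp : p = ldaModel V abar ∨ p = mixtureModel V)
    (K₀ : ℕ) (G₀ : MixingMeasure V) (hG₀ : G₀ ∈ exactAtoms V K₀) :
    -- distinct topics
    (minExactLength p G₀ ≤ ((2 * K₀ - 1 : ℕ) : ℕ∞) ∧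
      ∀ K : ℕ, K₀ < K → minOverfittedLength p G₀ K ≤ ((2 * K₀ : ℕ) : ℕ∞)) ∧
    -- topics of given rank and Kruskal rank
    ((2 ≤ K₀ → minExactLength p G₀ ≤
        ((⌈(2 * (K₀ : ℚ) - 1) / ((kruskalRank (topicVec G₀) : ℚ) - 1)⌉₊ : ℕ) : ℕ∞)) ∧
      ∀ K : ℕ, K₀ < K → minOverfittedLength p G₀ K ≤
        ((K + K₀ + 3 - 2 * familyRank (topicVec G₀) : ℕ) : ℕ∞)) ∧
    -- linearly independent topics
    (LinearIndependent ℝ (topicVec G₀) →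
      minExactLength p G₀ ≤ 3 ∧ ∀ K : ℕ, K₀ < K → minOverfittedLength p G₀ K ≤ 4) ∧
    -- anchor words
    (AnchorWord G₀ →
      minExactLength p G₀ ≤ 2 ∧ ∀ K : ℕ, K₀ < K → minOverfittedLength p G₀ K ≤ 2) := by
  obtain rfl : G₀.atoms.card = K₀ := hG₀
  have hmom : ∀ {N : ℕ} {G : MixingMeasure V}, 1 ≤ N → p G₀ N = p G N → MomentsAgree G G₀ N := by
    intro N G hN h
    rcases hp with rfl | rfl
    · exact momentsAgree_of_ldaModel hN habar h
    · exact momentsAgree_of_mixtureModel h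
  have hK₀ : 1 ≤ G₀.atoms.card := G₀.atoms_nonempty.card_pos
  refine ⟨⟨?_, fun K _ => ?_⟩, ⟨fun h2 => ?_, fun K hK => ?_⟩, fun hli => ⟨?_, fun K _ => ?_⟩,
    fun ha => ⟨?_, fun K _ => ?_⟩⟩
  · exact minExactLength_le (by omega) fun G hG h =>
      (hmom (by omega) h).eq_of_exactFitted (mem_atMostAtoms hG)
  · exact minOverfittedLength_le (by omega) fun G _ h => (hmom (by omega) h).eq_of_overfitted
  · have hk := two_le_kruskalRank h2
    have hk' := (kruskalRank_spec (topicVec G₀)).1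
    rw [Fintype.card_coe] at hk'
    set k := kruskalRank (topicVec G₀) with hkdef
    set N := ⌈(2 * (G₀.atoms.card : ℚ) - 1) / ((k : ℚ) - 1)⌉₊ with hNdef
    have hkq : (0 : ℚ) < (k : ℚ) - 1 := by
      have : (2 : ℚ) ≤ k := by exact_mod_cast hk
      linarith
    have h1 := Nat.le_ceil ((2 * (G₀.atoms.card : ℚ) - 1) / ((k : ℚ) - 1))
    rw [← hNdef, div_le_iff₀ hkq] at h1
    have h3 : 2 * G₀.atoms.card - 1 ≤ N * (k - 1) := by
      have : ((2 * G₀.atoms.card - 1 : ℕ) : ℚ) ≤ ((N * (k - 1) : ℕ) : ℚ) := by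
        push_cast [Nat.cast_sub (show 1 ≤ k by omega),
          Nat.cast_sub (show 1 ≤ 2 * G₀.atoms.card by omega)]
        exact h1
      exact_mod_cast this
    have hN : 1 ≤ N := by
      by_contra! hlt
      rw [Nat.lt_one_iff.1 hlt, zero_mul] at h3
      omega
    exact minExactLength_le hN fun G hG h => (hmom hN h).eq_of_allIndependent
      (mem_atMostAtoms hG) (allIndependent_kruskalRank G₀) hk' hk h3
  · have hR : familyRank (topicVec G₀) ≤ G₀.atoms.card := by
      have := finrank_range_le_card (R := ℝ) (topicVec G₀)
      rwa [Fintype.card_coe] at this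
    refine minOverfittedLength_le (by omega) fun G hG h => ?_
    refine (hmom (by omega) h).eq_of_rank (by omega) ?_
    have := mem_atMostAtoms hG
    rw [topicSpan_atoms]
    change _ ≤ _ + 2 * familyRank (topicVec G₀)
    omega
  · refine minExactLength_le (N := 3) (by omega) fun G hG h => ?_
    rcases hK₀.eq_or_lt with h1 | h1
    -- a single topic has Kruskal rank one, but then there are at most two atoms in all
    · refine (hmom (by omega) h).eq_of_card_union ((Finset.card_union_le _ _).trans ?_)
      have := mem_atMostAtoms hG
      omega
    · exact (hmom (by omega) h).eq_of_allIndependent (mem_atMostAtoms hG)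
        (AllIndependent.of_linearIndependent hli _) le_rfl h1 (by omega)
  · exact minOverfittedLength_le (N := 4) (by omega) fun G _ h =>
      (hmom (by omega) h).eq_of_linearIndependent hli
  · exact minExactLength_le (N := 2) (by omega) fun G _ h =>
      (hmom (by omega) h).eq_of_anchorWord ha
  · exact minOverfittedLength_le (N := 2) (by omega) fun G _ h =>
      (hmom (by omega) h).eq_of_anchorWord ha
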